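/- Let $X$ be a locally compact Hausdorff second countable space, and let $\theta\colon U\to V$ be a partial automorphism of $X$, that is, a homeomorphism between two open subsets $U,V$ of $X$. For a partial automorphism $\theta$ let $\{D_n\}_{n\in\mathbb{Z}}$, $D_n=\mathrm{Dom}(\theta^{-n})$, be the domains of the partial action $(\{D_n\},\{\theta^n\colon D_{-n}\to D_n\})$ of $\mathbb{Z}$ on $X$ generated by $\theta$, and let $C_0(X)\rtimes_\theta\mathbb{Z}$ be the partial crossed product, that is, the completion of the $*$-algebra of finite sums $\sum_n a_n\delta_n$ with $a_n\in C_0(D_n)$, with multiplication $(a\delta_m)(b\delta_n)=\theta_m(\theta_{-m}(a)b)\delta_{m+n}$ and involution $(a\delta_n)^*=\theta_{-n}(a^*)\delta_{-n}$, where $\theta_n\colon C_0(D_{-n})\to C_0(D_n)$ is $f\mapsto f\circ\theta^{-n}$, with respect to the seminorm $\|x\|_{\max}=\sup\{\|\pi(x)\| : \pi \text{ a } *\text{-representation}\}$. Then there exists an increasing sequence $(U_i)_{i\in\mathbb{N}}$ of open subsets of $X$ with $U=\bigcup_i U_i$ such that the restrictions $\theta^{(i)}=\theta|_{U_i}\colon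 U_i\to\theta(U_i)$ have the following properties. 1. For every $i$, the partial action generated by $\theta^{(i)}$ has regular open domains: $\mathrm{int}\big(\overline{D^{(i)}_n}\big)=D^{(i)}_n$ for all $n\in\mathbb{Z}$. 2. $C_0(X)\rtimes_\theta\mathbb{Z}=\varinjlim_i C_0(X)\rtimes_{\theta^{(i)}}\mathbb{Z}$ as $C^*$-algebras, where the connecting maps $C_0(X)\rtimes_{\theta^{(i)}}\mathbb{Z}\to C_0(X)\rtimes_{\theta^{(j)}}\mathbb{Z}$ for $i\le j$ and the maps $C_0(X)\rtimes_{\theta^{(i)}}\mathbb{Z}\to C_0(X)\rtimes_{\theta}\mathbb{Z}$ are the canonical $*$-homomorphisms $a\delta_n\mapsto a\delta_n$, induced by the inclusions $C_0(D^{(i)}_n)\subseteq C_0(D^{(j)}_n)\subseteq C_0(D_n)$. -/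

import Mathlib

open scoped ZeroAtInfty
open Set Topology

noncomputable section

namespace PartialDynamics

universe u v

/-- `e` is a restriction of `e'`: the domain of `e` is contained in that of `e'` and the two maps
agree there. -/
def IsRestriction {X : Type u} [TopologicalSpace X] (e e' : OpenPartialHomeomorph X X) : Prop :=
  ∀ x ∈ e.source, x ∈ e'.source ∧ e' x = e x

/-- A topological partial action of the discrete group `G` (written additively) on `X`: open sets
`D g` and homeomorphisms `θ g : D (-g) → D g` with `D 0 = X`, `θ 0 = id` and
`θ g ∘ θ h ⊆ θ (g + h)`. -/
structure PartialAction (G : Type v) [AddGroup G] (X : Type u) [TopologicalSpace X] where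
  /-- the domains `D g` -/
  dom : G → Set X
  /-- the homeomorphisms `θ g : D (-g) → D g` between open sets -/
  map : G → OpenPartialHomeomorph X X
  source_eq : ∀ g, (map g).source = dom (-g)
  target_eq : ∀ g, (map g).target = dom g
  dom_zero : dom 0 = univ
  zero_apply : ∀ x, map 0 x = x
  comp_subset : ∀ g h x, x ∈ (map h).source → map h x ∈ (map g).source →
    x ∈ (map (g + h)).source ∧ map (g + h) x = map g (map h x)

section Generated

variable {X : Type u} [TopologicalSpace X]

/-- The `n`-th power of a partial homeomorphism, on its natural domain, for `n : ℕ`. -/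
def natPow (θ : OpenPartialHomeomorph X X) : ℕ → OpenPartialHomeomorph X X
  | 0 => OpenPartialHomeomorph.refl X
  | n + 1 => (natPow θ n).trans θ

/-- The `n`-th power of a partial homeomorphism, on its natural domain, for `n : ℤ`. -/
def zPow (θ : OpenPartialHomeomorph X X) : ℤ → OpenPartialHomeomorph X X
  | Int.ofNat n => natPow θ n
  | Int.negSucc n => (natPow θ (n + 1)).symm

/-- `Rel e x y`: the partial map `e` is defined at `x`, with value `y`. -/
def Rel (e : OpenPartialHomeomorph X X) (x y : X) : Prop := x ∈ e.source ∧ e x = y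

theorem rel_symm {e : OpenPartialHomeomorph X X} {x y : X} : Rel e.symm x y ↔ Rel e y x := by
  constructor
  · rintro ⟨h, rfl⟩
    exact ⟨e.map_target h, e.right_inv h⟩
  · rintro ⟨h, rfl⟩
    exact ⟨e.map_source h, e.left_inv h⟩

theorem rel_trans {e e' : OpenPartialHomeomorph X X} {x z : X} :
    Rel (e.trans e') x z ↔ ∃ y, Rel e x y ∧ Rel e' y z := by
  simp only [Rel, OpenPartialHomeomorph.trans_source, mem_inter_iff, mem_preimage,
    OpenPartialHomeomorph.trans_apply]
  constructor
  · rintro ⟨⟨h1, h2⟩, h3⟩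
    exact ⟨_, ⟨h1, rfl⟩, h2, h3⟩
  · rintro ⟨y, ⟨h1, rfl⟩, h2, h3⟩
    exact ⟨⟨h1, h2⟩, h3⟩

theorem rel_natPow_succ' (θ : OpenPartialHomeomorph X X) (n : ℕ) {x z : X} :
    Rel (natPow θ (n + 1)) x z ↔ ∃ y, Rel θ x y ∧ Rel (natPow θ n) y z := by
  induction n generalizing z with
  | zero => simp [natPow, Rel]
  | succ n ih =>
    rw [natPow, rel_trans]
    constructor
    · rintro ⟨y, h1, h2⟩
      obtain ⟨w, h3, h4⟩ := ih.1 h1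
      exact ⟨w, h3, rel_trans.2 ⟨y, h4, h2⟩⟩
    · rintro ⟨w, h1, h2⟩
      obtain ⟨y, h3, h4⟩ := rel_trans.1 h2
      exact ⟨y, ih.2 ⟨w, h1, h3⟩, h4⟩

theorem rel_zPow_neg (θ : OpenPartialHomeomorph X X) (n : ℤ) {x y : X} :
    Rel (zPow θ (-n)) x y ↔ Rel (zPow θ n) y x := by
  rcases n with (_ | n) | n
  · change Rel (OpenPartialHomeomorph.refl X) x y ↔ Rel (OpenPartialHomeomorph.refl X) y x
    simp [Rel, eq_comm]
  · change Rel (natPow θ (n + 1)).symm x y ↔ _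
    rw [rel_symm]; rfl
  · change Rel (natPow θ (n + 1)) x y ↔ Rel (natPow θ (n + 1)).symm y x
    rw [rel_symm]

theorem rel_zPow_add_one {θ : OpenPartialHomeomorph X X} {n : ℤ} {x y z : X}
    (h : Rel (zPow θ n) x y) (h' : Rel θ y z) : Rel (zPow θ (n + 1)) x z := by
  rcases n with n | n
  · exact rel_trans.2 ⟨y, h, h'⟩
  · have h2 : Rel (natPow θ (n + 1)) y x := rel_symm.1 h
    obtain ⟨w, hw, hw'⟩ := (rel_natPow_succ' θ n).1 h2
    obtain rfl : w = z := hw.2.symm.trans h'.2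
    have : (Int.negSucc n + 1 : ℤ) = -(n : ℤ) := by omega
    rw [this, rel_zPow_neg]
    exact hw'

theorem rel_zPow_sub_one {θ : OpenPartialHomeomorph X X} {n : ℤ} {x y z : X}
    (h : Rel (zPow θ n) x y) (h' : Rel θ z y) : Rel (zPow θ (n - 1)) x z := by
  rcases n with (_ | n) | n
  · obtain rfl : x = y := h.2
    change Rel (natPow θ (0 + 1)).symm x z
    rw [rel_symm]
    exact (rel_natPow_succ' θ 0).2 ⟨x, h', h⟩
  · obtain ⟨w, hw, hw'⟩ := rel_trans.1 (h : Rel ((natPow θ n).trans θ) x y)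
    obtain rfl : w = z := θ.injOn hw'.1 h'.1 (hw'.2.trans h'.2.symm)
    have : (Int.ofNat (n + 1) - 1 : ℤ) = n := by simp
    rw [this]
    exact hw
  · have h2 : Rel (natPow θ (n + 1)) y x := rel_symm.1 h
    have : (Int.negSucc n - 1 : ℤ) = Int.negSucc (n + 1) := by omega
    rw [this]
    exact rel_symm.2 ((rel_natPow_succ' θ (n + 1)).2 ⟨y, h', h2⟩)

theorem rel_zPow_add {θ : OpenPartialHomeomorph X X} {g h : ℤ} {x y z : X}
    (h1 : Rel (zPow θ h) x y) (h2 : Rel (zPow θ g) y z) : Rel (zPow θ (g + h)) x z := by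
  induction g using Int.induction_on generalizing z with
  | zero =>
    obtain rfl : y = z := h2.2
    simpa using h1
  | succ n ih =>
    obtain ⟨w, hw, hw'⟩ := rel_trans.1 (h2 : Rel ((natPow θ n).trans θ) y z)
    have := rel_zPow_add_one (ih hw) hw'
    rwa [add_right_comm] at this
  | pred n ih =>
    have h3 : Rel (zPow θ (-(-(n : ℤ) - 1))) z y := (rel_zPow_neg θ _).2 h2
    have e : (-(-(n : ℤ) - 1)) = Int.ofNat (n + 1) := by simp [add_comm]
    rw [e] at h3
    obtain ⟨w, hw, hw'⟩ := (rel_natPow_succ' θ n).1 h3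
    have := rel_zPow_sub_one (ih ((rel_zPow_neg θ n).2 hw')) hw
    rwa [show -(n : ℤ) - 1 + h = -(n : ℤ) + h - 1 by ring]

theorem zPow_neg_source (θ : OpenPartialHomeomorph X X) (n : ℤ) :
    (zPow θ (-n)).source = (zPow θ n).target := by
  ext x
  constructor
  · intro hx
    have h := (rel_zPow_neg θ n).1 ⟨hx, rfl⟩
    rw [← h.2]
    exact (zPow θ n).map_source h.1
  · intro hx
    exact ((rel_zPow_neg θ n).2 ⟨(zPow θ n).map_target hx, (zPow θ n).right_inv hx⟩).1

/-- The partial action of `ℤ` generated by a partial automorphism `θ`: `D n = Dom (θ ^ (-n))` and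
`θ n = θ ^ n`. -/
def generated (θ : OpenPartialHomeomorph X X) : PartialAction ℤ X where
  dom n := (zPow θ (-n)).source
  map n := zPow θ n
  source_eq n := by rw [neg_neg]
  target_eq n := (zPow_neg_source θ n).symm
  dom_zero := rfl
  zero_apply _ := rfl
  comp_subset _ _ _ hx hy := rel_zPow_add ⟨hx, rfl⟩ ⟨hy, rfl⟩

end Generated

/-- A partial action `α` is a restriction of `β`: every map of `α` is a restriction of the
corresponding map of `β`. -/
def PartialAction.IsRestriction {G : Type v} [AddGroup G] {X : Type u} [TopologicalSpace X]
    (α β : PartialAction G X) : Prop :=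
  ∀ g, PartialDynamics.IsRestriction (α.map g) (β.map g)

theorem IsRestriction.rel {X : Type u} [TopologicalSpace X] {e e' : OpenPartialHomeomorph X X}
    (h : IsRestriction e e') {x y : X} (hx : Rel e x y) : Rel e' x y :=
  ⟨(h x hx.1).1, (h x hx.1).2.trans hx.2⟩

theorem IsRestriction.natPow {X : Type u} [TopologicalSpace X] {e e' : OpenPartialHomeomorph X X}
    (h : IsRestriction e e') (n : ℕ) {x y : X} (hx : Rel (natPow e n) x y) :
    Rel (natPow e' n) x y := by
  induction n generalizing y with
  | zero => exact hx
  | succ n ih =>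
    obtain ⟨w, hw, hw'⟩ := rel_trans.1 hx
    exact rel_trans.2 ⟨w, ih hw, h.rel hw'⟩

/-- The partial action generated by a restriction of `θ` is a restriction of the one generated
by `θ`. -/
theorem IsRestriction.generated {X : Type u} [TopologicalSpace X]
    {e e' : OpenPartialHomeomorph X X} (h : IsRestriction e e') :
    (generated e).IsRestriction (generated e') := by
  intro n x hx
  change Rel (zPow e' n) x (zPow e n x)
  rcases n with n | n
  · exact h.natPow n ⟨hx, rfl⟩
  · exact rel_symm.2 (h.natPow (n + 1) (rel_symm.1 ⟨hx, rfl⟩))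

/-- A set is regular open if it is the interior of its closure. -/
def IsRegularOpen {X : Type u} [TopologicalSpace X] (U : Set X) : Prop :=
  interior (closure U) = U

section Functions

variable {X : Type u} [TopologicalSpace X]

/-- The ideal `C₀(U)` of `C₀(X)`: functions vanishing outside `U`. -/
def ideal (U : Set X) : Submodule ℂ C₀(X, ℂ) where
  carrier := {f | ∀ x, x ∉ U → f x = 0}
  add_mem' {f g} hf hg x hx := by simp [hf x hx, hg x hx]
  zero_mem' _ _ := rfl
  smul_mem' c f hf x hx := by simp [hf x hx]

theorem mem_ideal {U : Set X} {f : C₀(X, ℂ)} : f ∈ ideal U ↔ ∀ x, x ∉ U → f x = 0 := Iff.rfl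

open Classical in
theorem pushFun_small (e : OpenPartialHomeomorph X X) (f : C₀(X, ℂ)) (hf : f ∈ ideal e.source)
    {ε : ℝ} (hε : 0 < ε) : ∃ K : Set X, IsCompact K ∧ K ⊆ e.target ∧
      ∀ x, x ∉ K → ‖if x ∈ e.target then f (e.symm x) else 0‖ < ε := by
  have h0 : {x | ‖f x‖ < ε} ∈ Filter.cocompact X := by
    have := (zero_at_infty f).norm
    rw [norm_zero] at this
    exact this.eventually_lt_const hε
  obtain ⟨t, ht, hts⟩ := Filter.mem_cocompact.1 h0
  have hK : IsCompact {x | ε ≤ ‖f x‖} := by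
    refine ht.of_isClosed_subset (isClosed_le continuous_const (by fun_prop)) fun x hx => ?_
    by_contra hxt
    exact not_lt.2 (show ε ≤ ‖f x‖ from hx) (hts hxt)
  have hKs : {x | ε ≤ ‖f x‖} ⊆ e.source := by
    intro x hx
    by_contra hxs
    have : ε ≤ ‖f x‖ := hx
    rw [hf x hxs, norm_zero] at this
    exact absurd hε (not_lt.2 this)
  refine ⟨e '' {x | ε ≤ ‖f x‖}, hK.image_of_continuousOn (e.continuousOn.mono hKs), ?_, ?_⟩
  · rintro _ ⟨x, hx, rfl⟩
    exact e.map_source (hKs hx)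
  · intro x hx
    split_ifs with hxt
    · by_contra hlt
      exact hx ⟨e.symm x, not_lt.1 hlt, e.right_inv hxt⟩
    · rwa [norm_zero]

variable [T2Space X]

open Classical in
/-- The image of `f ∈ C₀(dom e)` under a homeomorphism `e` between open sets:
`f ∘ e⁻¹` on the range of `e`, and zero elsewhere. -/
def pushFun (e : OpenPartialHomeomorph X X) (f : C₀(X, ℂ)) (hf : f ∈ ideal e.source) :
    C₀(X, ℂ) where
  toFun x := if x ∈ e.target then f (e.symm x) else 0
  continuous_toFun := by
    rw [continuous_iff_continuousAt]
    intro x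
    by_cases hx : x ∈ e.target
    · have h1 : ContinuousAt (fun y => f (e.symm y)) x :=
        ContinuousAt.comp (map_continuous f).continuousAt (e.continuousAt_symm hx)
      refine h1.congr ?_
      filter_upwards [e.open_target.mem_nhds hx] with y hy
      rw [if_pos hy]
    · rw [Metric.continuousAt_iff']
      intro ε hε
      obtain ⟨K, hK, hKt, hsmall⟩ := pushFun_small e f hf hε
      filter_upwards [hK.isClosed.isOpen_compl.mem_nhds fun h => hx (hKt h)] with y hy
      rw [if_neg hx, dist_zero_right]
      exact hsmall y hy
  zero_at_infty' := by
    rw [Metric.tendsto_nhds]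
    intro ε hε
    obtain ⟨K, hK, -, hsmall⟩ := pushFun_small e f hf hε
    filter_upwards [hK.compl_mem_cocompact] with y hy
    rw [dist_zero_right]
    exact hsmall y hy

open Classical in
/-- The linear map `C₀(U) → C₀(V)`, `f ↦ f ∘ e⁻¹`, induced by a homeomorphism `e : U → V` between
open subsets of `X`. -/
def push (e : OpenPartialHomeomorph X X) {U V : Set X} (hU : e.source = U) (hV : e.target = V) :
    ideal U →ₗ[ℂ] ideal V where
  toFun f := ⟨pushFun e f (by rw [hU]; exact f.2), fun x hx => if_neg (by rwa [hV])⟩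
  map_add' f g := by
    ext x
    change (if x ∈ e.target then f.1 (e.symm x) + g.1 (e.symm x) else 0) =
      (if x ∈ e.target then f.1 (e.symm x) else 0) + if x ∈ e.target then g.1 (e.symm x) else 0
    split_ifs <;> simp
  map_smul' c f := by
    ext x
    change (if x ∈ e.target then c * f.1 (e.symm x) else 0) =
      c * if x ∈ e.target then f.1 (e.symm x) else 0
    split_ifs <;> simp

theorem push_of_rel (e : OpenPartialHomeomorph X X) {U V : Set X} (hU : e.source = U)
    (hV : e.target = V) (f : ideal U) {x y : X} (h : Rel e x y) :
    (push e hU hV f).1 y = f.1 x := by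
  obtain ⟨h1, rfl⟩ := h
  refine (if_pos (e.map_source h1)).trans ?_
  rw [e.left_inv h1]

theorem push_of_notMem (e : OpenPartialHomeomorph X X) {U V : Set X} (hU : e.source = U)
    (hV : e.target = V) (f : ideal U) {y : X} (h : y ∉ e.target) :
    (push e hU hV f).1 y = 0 :=
  if_neg h

end Functions

namespace PartialAction

variable {G : Type v} [AddGroup G] {X : Type u} [TopologicalSpace X] (α : PartialAction G X)

theorem comp_rel {g h : G} {x y z : X} (h1 : Rel (α.map h) x y) (h2 : Rel (α.map g) y z) :
    Rel (α.map (g + h)) x z := by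
  obtain ⟨h1, rfl⟩ := h1
  obtain ⟨h2, rfl⟩ := h2
  exact α.comp_subset g h x h1 h2

theorem rel_zero {x y : X} (h : Rel (α.map 0) x y) : x = y := by
  rw [← h.2, α.zero_apply]

theorem source_neg (g : G) : (α.map (-g)).source = α.dom g := by rw [α.source_eq, neg_neg]

theorem rel_neg {g : G} {x y : X} (h : Rel (α.map g) x y) : Rel (α.map (-g)) y x := by
  have hy : y ∈ (α.map (-g)).source := by
    rw [source_neg, ← α.target_eq, ← h.2]
    exact (α.map g).map_source h.1
  have := α.comp_rel h ⟨hy, rfl⟩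
  rw [neg_add_cancel] at this
  exact ⟨hy, (α.rel_zero this).symm⟩

theorem rel_neg_iff {g : G} {x y : X} : Rel (α.map (-g)) x y ↔ Rel (α.map g) y x := by
  constructor
  · intro h
    simpa using α.rel_neg h
  · exact α.rel_neg

theorem exists_rel_of_mem {g : G} {y : X} (h : y ∈ α.dom g) : ∃ x, Rel (α.map g) x y := by
  rw [← α.target_eq] at h
  exact ⟨_, (α.map g).map_target h, (α.map g).right_inv h⟩

theorem mem_of_rel {g : G} {x y : X} (h : Rel (α.map g) x y) : y ∈ α.dom g := by
  rw [← α.target_eq, ← h.2]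
  exact (α.map g).map_source h.1

theorem coe_eq_zero {g : G} (a : ideal (α.dom g)) {y : X} (h : y ∉ α.dom g) : a.1 y = 0 := a.2 y h

variable [T2Space X]

/-- The isomorphism `θ g : C₀(D (-g)) → C₀(D g)` induced by `θ g : D (-g) → D g`. -/
def act (g : G) : ideal (α.dom (-g)) →ₗ[ℂ] ideal (α.dom g) :=
  push (α.map g) (α.source_eq g) (α.target_eq g)

/-- The isomorphism `θ (-g) : C₀(D g) → C₀(D (-g))` induced by `θ (-g) : D g → D (-g)`. -/
def actNeg (g : G) : ideal (α.dom g) →ₗ[ℂ] ideal (α.dom (-g)) :=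
  push (α.map (-g)) (α.source_neg g) (α.target_eq (-g))

theorem act_of_rel {g : G} (f : ideal (α.dom (-g))) {x y : X} (h : Rel (α.map g) x y) :
    (α.act g f).1 y = f.1 x :=
  push_of_rel _ _ _ f h

theorem actNeg_of_rel {g : G} (f : ideal (α.dom g)) {x y : X} (h : Rel (α.map g) x y) :
    (α.actNeg g f).1 x = f.1 y :=
  push_of_rel _ _ _ f (α.rel_neg h)

/-- The product `(a δ_g) (b δ_h) = θ_g (θ_{-g} (a) b) δ_{g+h}`. -/
def coeffMul {g h : G} (a : ideal (α.dom g)) (b : ideal (α.dom h)) : ideal (α.dom (g + h)) :=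
  ⟨α.act g ⟨(α.actNeg g a).1 * b.1, fun x hx => by
      rw [ZeroAtInftyContinuousMap.mul_apply, (α.actNeg g a).2 x hx, zero_mul]⟩, by
    intro y hy
    by_cases hg : y ∈ α.dom g
    · obtain ⟨x, hx⟩ := α.exists_rel_of_mem hg
      rw [α.act_of_rel _ hx]
      by_cases hh : x ∈ α.dom h
      · obtain ⟨w, hw⟩ := α.exists_rel_of_mem hh
        exact absurd (α.mem_of_rel (α.comp_rel hw hx)) hy
      · change (α.actNeg g a).1 x * b.1 x = 0
        rw [α.coe_eq_zero b hh, mul_zero]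
    · exact α.coe_eq_zero _ hg⟩

theorem coeffMul_of_rel {g h : G} (a : ideal (α.dom g)) (b : ideal (α.dom h)) {x y : X}
    (hx : Rel (α.map g) x y) : (α.coeffMul a b).1 y = a.1 y * b.1 x := by
  refine (α.act_of_rel _ hx).trans ?_
  change (α.actNeg g a).1 x * b.1 x = _
  rw [α.actNeg_of_rel a hx]

theorem coeffMul_of_notMem {g h : G} (a : ideal (α.dom g)) (b : ideal (α.dom h)) {y : X}
    (hy : y ∉ α.dom g) : (α.coeffMul a b).1 y = 0 :=
  α.coe_eq_zero (α.act g _) hy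

/-- The adjoint `(a δ_g)^* = θ_{-g} (a^*) δ_{-g}`. -/
def coeffStar {g : G} (a : ideal (α.dom g)) : ideal (α.dom (-g)) :=
  α.actNeg g ⟨star a.1, fun x hx => by
    rw [ZeroAtInftyContinuousMap.star_apply, a.2 x hx, star_zero]⟩

theorem coeffStar_of_rel {g : G} (a : ideal (α.dom g)) {x y : X}
    (hx : Rel (α.map g) x y) : (α.coeffStar a).1 x = star (a.1 y) :=
  α.actNeg_of_rel _ hx

theorem coeff_assoc {g h k : G} (a : ideal (α.dom g)) (b : ideal (α.dom h)) (c : ideal (α.dom k))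
    (y : X) : (α.coeffMul (α.coeffMul a b) c).1 y = (α.coeffMul a (α.coeffMul b c)).1 y := by
  by_cases hg : y ∈ α.dom g
  · obtain ⟨x, hx⟩ := α.exists_rel_of_mem hg
    rw [α.coeffMul_of_rel _ _ hx]
    by_cases hh : x ∈ α.dom h
    · obtain ⟨w, hw⟩ := α.exists_rel_of_mem hh
      rw [α.coeffMul_of_rel _ _ (α.comp_rel hw hx), α.coeffMul_of_rel _ _ hx,
        α.coeffMul_of_rel _ _ hw, mul_assoc]
    · rw [α.coeffMul_of_notMem _ _ hh, mul_zero]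
      by_cases hgh : y ∈ α.dom (g + h)
      · obtain ⟨w, hw⟩ := α.exists_rel_of_mem hgh
        rw [α.coeffMul_of_rel _ _ hw, α.coeffMul_of_rel _ _ hx, α.coe_eq_zero b hh, mul_zero,
          zero_mul]
      · exact α.coeffMul_of_notMem _ _ hgh
  · rw [α.coeffMul_of_notMem a _ hg]
    by_cases hgh : y ∈ α.dom (g + h)
    · obtain ⟨w, hw⟩ := α.exists_rel_of_mem hgh
      rw [α.coeffMul_of_rel _ _ hw, α.coeffMul_of_notMem a _ hg, zero_mul]
    · exact α.coeffMul_of_notMem _ _ hgh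

theorem coeffStar_of_notMem {g : G} (a : ideal (α.dom g)) {x : X} (hx : x ∉ α.dom (-g)) :
    (α.coeffStar a).1 x = 0 :=
  α.coe_eq_zero (α.coeffStar a) hx

theorem coeffStar_apply_eq {g : G} (a : ideal (α.dom g)) (z : ℂ) (x : X)
    (h1 : ∀ y, Rel (α.map g) x y → z = star (a.1 y)) (h2 : x ∉ α.dom (-g) → z = 0) :
    (α.coeffStar a).1 x = z := by
  by_cases hx : x ∈ α.dom (-g)
  · obtain ⟨y, hy⟩ := α.exists_rel_of_mem hx
    have hy := α.rel_neg_iff.1 hy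
    rw [α.coeffStar_of_rel a hy, h1 y hy]
  · rw [α.coeffStar_of_notMem a hx, h2 hx]

theorem coeffStar_coeffStar {g : G} (a : ideal (α.dom g)) (x : X) :
    (α.coeffStar (α.coeffStar a)).1 x = a.1 x := by
  refine α.coeffStar_apply_eq _ _ _ (fun y hy => ?_) fun hx => ?_
  · rw [α.coeffStar_of_rel a (α.rel_neg_iff.1 hy), star_star]
  · rw [neg_neg] at hx
    exact α.coe_eq_zero a hx

theorem coeffStar_coeffMul {g h : G} (a : ideal (α.dom g)) (b : ideal (α.dom h)) (x : X) :
    (α.coeffStar (α.coeffMul a b)).1 x = (α.coeffMul (α.coeffStar b) (α.coeffStar a)).1 x := by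
  by_cases hx : x ∈ α.dom (-h)
  · obtain ⟨y, hy⟩ := α.exists_rel_of_mem hx
    rw [α.coeffMul_of_rel _ _ hy]
    have hy := α.rel_neg_iff.1 hy
    rw [α.coeffStar_of_rel b hy]
    refine α.coeffStar_apply_eq _ _ _ (fun z hz => ?_) fun hx' => ?_
    · have hyz : Rel (α.map g) y z := by
        have := α.comp_rel (α.rel_neg hy) hz
        rwa [add_neg_cancel_right] at this
      rw [α.coeffStar_of_rel a hyz, α.coeffMul_of_rel a b hyz, star_mul]
    · by_cases hy' : y ∈ α.dom (-g)
      · obtain ⟨z, hz⟩ := α.exists_rel_of_mem hy'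
        have := α.comp_rel hy (α.rel_neg_iff.1 hz)
        exact absurd (α.mem_of_rel (α.rel_neg this)) hx'
      · rw [α.coeffStar_of_notMem a hy', mul_zero]
  · rw [α.coeffMul_of_notMem _ _ hx]
    refine α.coeffStar_apply_eq _ _ _ (fun z hz => ?_) fun hx' => rfl
    by_cases hzg : z ∈ α.dom g
    · obtain ⟨y, hy⟩ := α.exists_rel_of_mem hzg
      rw [α.coeffMul_of_rel a b hy]
      by_cases hyh : y ∈ α.dom h
      · exfalso
        have := α.comp_rel hz (α.rel_neg hy)
        rw [neg_add_cancel_left] at this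
        exact hx (α.mem_of_rel (α.rel_neg this))
      · rw [α.coe_eq_zero b hyh, mul_zero, star_zero]
    · rw [α.coeffMul_of_notMem _ _ hzg, star_zero]

end PartialAction

namespace PartialAction

variable {G : Type v} [AddGroup G] {X : Type u} [TopologicalSpace X]

/-- The algebraic partial crossed product `C₀(X) ⋊_{α,alg} G`: finitely supported families
`(a_g)` with `a_g ∈ C₀(D g)`. -/
def Alg (α : PartialAction G X) : Type max u v := DirectSum G fun g => ideal (α.dom g)

variable (α : PartialAction G X)

instance : AddCommMonoid α.Alg :=
  inferInstanceAs (AddCommMonoid (DirectSum G fun g => ideal (α.dom g)))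

instance : Module ℂ α.Alg := inferInstanceAs (Module ℂ (DirectSum G fun g => ideal (α.dom g)))

instance : AddCommGroup α.Alg := Module.addCommMonoidToAddCommGroup ℂ

variable [DecidableEq G]

/-- The element `a δ_g`. -/
def δ (g : G) : ideal (α.dom g) →ₗ[ℂ] α.Alg := DirectSum.lof ℂ G (fun g => ideal (α.dom g)) g

/-- The linear map on `C₀(X) ⋊_{α,alg} G` with given values on the elements `a δ_g`. -/
def lift {N : Type*} [AddCommMonoid N] [Module ℂ N] (f : ∀ g, ideal (α.dom g) →ₗ[ℂ] N) :
    α.Alg →ₗ[ℂ] N :=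
  DirectSum.toModule ℂ G N f

theorem lift_δ {N : Type*} [AddCommMonoid N] [Module ℂ N] (f : ∀ g, ideal (α.dom g) →ₗ[ℂ] N)
    (g : G) (a : ideal (α.dom g)) : α.lift f (α.δ g a) = f g a :=
  DirectSum.toModule_lof ℂ (φ := f) g a

/-- The additive map on `C₀(X) ⋊_{α,alg} G` with given values on the elements `a δ_g`. -/
def liftAdd {N : Type*} [AddCommMonoid N] (f : ∀ g, ideal (α.dom g) →+ N) : α.Alg →+ N :=
  DirectSum.toAddMonoid f

theorem liftAdd_δ {N : Type*} [AddCommMonoid N] (f : ∀ g, ideal (α.dom g) →+ N)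
    (g : G) (a : ideal (α.dom g)) : α.liftAdd f (α.δ g a) = f g a :=
  DirectSum.toAddMonoid_of f g a

theorem δ_congr {g h : G} (e : g = h) {a : ideal (α.dom g)} {b : ideal (α.dom h)}
    (hab : ∀ x, a.1 x = b.1 x) : α.δ g a = α.δ h b := by
  subst e
  congr 1
  ext x
  exact hab x

theorem alg_induction {p : α.Alg → Prop} (x : α.Alg) (h0 : p 0) (hδ : ∀ g a, p (α.δ g a))
    (hadd : ∀ x y, p x → p y → p (x + y)) : p x :=
  DirectSum.induction_on x h0 hδ hadd

variable [T2Space X]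

/-- `coeffMul` as a bilinear map. -/
def coeffMulₗ (g h : G) :
    ideal (α.dom g) →ₗ[ℂ] ideal (α.dom h) →ₗ[ℂ] ideal (α.dom (g + h)) :=
  LinearMap.mk₂ ℂ (fun a b => α.coeffMul a b)
    (fun a a' b => by
      ext y
      by_cases hy : y ∈ α.dom g
      · obtain ⟨x, hx⟩ := α.exists_rel_of_mem hy
        simp [α.coeffMul_of_rel _ _ hx, add_mul]
      · simp [α.coeffMul_of_notMem _ _ hy])
    (fun c a b => by
      ext y
      by_cases hy : y ∈ α.dom g
      · obtain ⟨x, hx⟩ := α.exists_rel_of_mem hy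
        simp [α.coeffMul_of_rel _ _ hx, mul_assoc]
      · simp [α.coeffMul_of_notMem _ _ hy])
    (fun a b b' => by
      ext y
      by_cases hy : y ∈ α.dom g
      · obtain ⟨x, hx⟩ := α.exists_rel_of_mem hy
        simp [α.coeffMul_of_rel _ _ hx, mul_add]
      · simp [α.coeffMul_of_notMem _ _ hy])
    (fun c a b => by
      ext y
      by_cases hy : y ∈ α.dom g
      · obtain ⟨x, hx⟩ := α.exists_rel_of_mem hy
        simp [α.coeffMul_of_rel _ _ hx, mul_left_comm]
      · simp [α.coeffMul_of_notMem _ _ hy])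

/-- The multiplication of `C₀(X) ⋊_{α,alg} G`, the bilinear extension of
`(a δ_g) (b δ_h) = θ_g (θ_{-g} (a) b) δ_{g+h}`. -/
def mulₗ : α.Alg →ₗ[ℂ] α.Alg →ₗ[ℂ] α.Alg :=
  α.lift fun g => LinearMap.flip (α.lift fun h => ((α.coeffMulₗ g h).compr₂ (α.δ (g + h))).flip)

instance : Mul α.Alg := ⟨fun x y => α.mulₗ x y⟩

theorem δ_mul_δ {g h : G} (a : ideal (α.dom g)) (b : ideal (α.dom h)) :
    α.δ g a * α.δ h b = α.δ (g + h) (α.coeffMul a b) := by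
  change α.mulₗ (α.δ g a) (α.δ h b) = _
  simp only [mulₗ, lift_δ, LinearMap.flip_apply]
  rfl

instance : NonUnitalRing α.Alg where
  left_distrib x y z := map_add (α.mulₗ x) y z
  right_distrib x y z := LinearMap.map_add₂ α.mulₗ x y z
  zero_mul x := LinearMap.map_zero₂ α.mulₗ x
  mul_zero x := map_zero (α.mulₗ x)
  mul_assoc x y z := by
    change α.mulₗ (α.mulₗ x y) z = α.mulₗ x (α.mulₗ y z)
    induction x using α.alg_induction with
    | h0 => simp
    | hadd x x' hx hx' => simp only [map_add, LinearMap.add_apply, hx, hx']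
    | hδ g a =>
      induction y using α.alg_induction with
      | h0 => simp
      | hadd y y' hy hy' => simp only [map_add, LinearMap.add_apply, hy, hy']
      | hδ h b =>
        induction z using α.alg_induction with
        | h0 => simp
        | hadd z z' hz hz' => simp only [map_add, hz, hz']
        | hδ k c =>
          change α.δ g a * α.δ h b * α.δ k c = α.δ g a * (α.δ h b * α.δ k c)
          simp only [δ_mul_δ]
          exact α.δ_congr (add_assoc g h k) (α.coeff_assoc a b c)

instance : IsScalarTower ℂ α.Alg α.Alg := ⟨fun c x y => LinearMap.map_smul₂ α.mulₗ c x y⟩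

instance : SMulCommClass ℂ α.Alg α.Alg := ⟨fun c x y => ((α.mulₗ x).map_smul c y).symm⟩

/-- `coeffStar` as a conjugate-linear map. -/
def coeffStarₗ (g : G) : ideal (α.dom g) →ₗ⋆[ℂ] ideal (α.dom (-g)) where
  toFun := α.coeffStar
  map_add' a b := by
    ext x
    refine α.coeffStar_apply_eq _ _ _ (fun y hy => ?_) fun hx => ?_
    · simp [α.coeffStar_of_rel _ hy]
    · simp [α.coeffStar_of_notMem _ hx]
  map_smul' c a := by
    ext x
    refine α.coeffStar_apply_eq _ _ _ (fun y hy => ?_) fun hx => ?_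
    · simp [α.coeffStar_of_rel _ hy]
    · simp [α.coeffStar_of_notMem _ hx]

/-- The involution of `C₀(X) ⋊_{α,alg} G`, the additive extension of
`(a δ_g)^* = θ_{-g} (a^*) δ_{-g}`. -/
def starHom : α.Alg →+ α.Alg :=
  α.liftAdd fun g => (α.δ (-g)).toAddMonoidHom.comp (α.coeffStarₗ g).toAddMonoidHom

instance : Star α.Alg := ⟨fun x => α.starHom x⟩

theorem star_δ {g : G} (a : ideal (α.dom g)) : star (α.δ g a) = α.δ (-g) (α.coeffStar a) := by
  change α.starHom (α.δ g a) = _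
  exact α.liftAdd_δ _ g a

instance : StarRing α.Alg where
  star_add x y := map_add α.starHom x y
  star_involutive x := by
    change α.starHom (α.starHom x) = x
    induction x using α.alg_induction with
    | h0 => simp
    | hadd x x' hx hx' => simp only [map_add, hx, hx']
    | hδ g a =>
      change star (star (α.δ g a)) = α.δ g a
      rw [star_δ, star_δ]
      exact α.δ_congr (neg_neg g) (α.coeffStar_coeffStar a)
  star_mul x y := by
    change α.starHom (α.mulₗ x y) = α.mulₗ (α.starHom y) (α.starHom x)
    induction x using α.alg_induction with
    | h0 => simp
    | hadd x x' hx hx' => simp only [map_add, LinearMap.add_apply, hx, hx']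
    | hδ g a =>
      induction y using α.alg_induction with
      | h0 => simp
      | hadd y y' hy hy' => simp only [map_add, LinearMap.add_apply, hy, hy']
      | hδ h b =>
        change star (α.δ g a * α.δ h b) = star (α.δ h b) * star (α.δ g a)
        rw [star_δ, star_δ, δ_mul_δ, δ_mul_δ, star_δ]
        exact α.δ_congr (neg_add_rev g h) (α.coeffStar_coeffMul a b)

instance : StarModule ℂ α.Alg where
  star_smul c x := by
    change α.starHom (c • x) = star c • α.starHom x
    induction x using α.alg_induction with
    | h0 => simp
    | hadd x x' hx hx' => simp only [smul_add, map_add, hx, hx']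
    | hδ g a =>
      change star (c • α.δ g a) = star c • star (α.δ g a)
      rw [← map_smul, star_δ, star_δ, ← map_smul]
      exact congrArg _ ((α.coeffStarₗ g).map_smulₛₗ c a)

end PartialAction

namespace PartialAction

variable {G : Type v} [AddGroup G] [DecidableEq G] {X : Type u} [TopologicalSpace X] [T2Space X]
  (α : PartialAction G X)

/-- The values `‖π x‖`, where `π` runs over the `*`-representations of `C₀(X) ⋊_{α,alg} G` by
bounded operators on (complex) Hilbert spaces. -/
def repNorms (x : α.Alg) : Set ℝ :=
  {r | ∃ (H : Type (max u v)) (_ : NormedAddCommGroup H) (_ : InnerProductSpace ℂ H)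
    (_ : CompleteSpace H) (π : α.Alg →⋆ₙₐ[ℂ] (H →L[ℂ] H)), r = ‖π x‖}

/-- The maximal seminorm `‖x‖ = sup {‖π x‖ : π a *-representation}`. -/
def maxNorm (x : α.Alg) : ℝ := sSup (α.repNorms x)

theorem repNorms_nonempty (x : α.Alg) : (α.repNorms x).Nonempty :=
  ⟨_, EuclideanSpace ℂ PEmpty.{(max u v) + 1}, inferInstance, inferInstance, inferInstance, 0, rfl⟩

/-- The embedding `a ↦ a δ_0` of `C₀(X)`. -/
def zeroHom : C₀(X, ℂ) →⋆ₙₐ[ℂ] α.Alg where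
  toFun a := α.δ 0 ⟨a, fun x hx => absurd (by rw [α.dom_zero]; trivial) hx⟩
  map_smul' c a := (α.δ 0).map_smul c ⟨a, _⟩
  map_zero' := (α.δ 0).map_zero
  map_add' a b := (α.δ 0).map_add ⟨a, _⟩ ⟨b, _⟩
  map_mul' a b := by
    rw [δ_mul_δ]
    refine α.δ_congr (add_zero 0).symm fun y => ?_
    obtain ⟨x, hx⟩ := α.exists_rel_of_mem (g := 0) (y := y) (by rw [α.dom_zero]; trivial)
    rw [α.coeffMul_of_rel _ _ hx, α.rel_zero hx]
    rfl
  map_star' a := by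
    rw [star_δ]
    refine α.δ_congr neg_zero.symm fun y => (α.coeffStar_apply_eq _ _ _ (fun x hx => ?_) ?_).symm
    · rw [α.rel_zero hx]
      rfl
    · intro h
      rw [neg_zero, α.dom_zero] at h
      exact absurd trivial h

theorem norm_rep_δ_le {B : Type*} [NonUnitalCStarAlgebra B] (π : α.Alg →⋆ₙₐ[ℂ] B) {g : G}
    (a : ideal (α.dom g)) : ‖π (α.δ g a)‖ ≤ ‖a.1‖ := by
  have h1 : α.δ g a * star (α.δ g a) = α.zeroHom (a.1 * star a.1) := by
    rw [star_δ, δ_mul_δ]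
    refine α.δ_congr (add_neg_cancel g) fun y => ?_
    by_cases hy : y ∈ α.dom g
    · obtain ⟨x, hx⟩ := α.exists_rel_of_mem hy
      rw [α.coeffMul_of_rel _ _ hx, α.coeffStar_of_rel a hx]
      rfl
    · rw [α.coeffMul_of_notMem _ _ hy]
      change 0 = a.1 y * star (a.1 y)
      rw [α.coe_eq_zero a hy, zero_mul]
  have h2 : ‖π (α.δ g a)‖ * ‖π (α.δ g a)‖ ≤ ‖a.1‖ * ‖a.1‖ := by
    rw [← CStarRing.norm_self_mul_star, ← CStarRing.norm_self_mul_star (x := a.1), ← map_star,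
      ← map_mul, h1]
    exact NonUnitalStarAlgHom.norm_apply_le (π.comp α.zeroHom) (a.1 * star a.1)
  exact abs_le_of_sq_le_sq' (by nlinarith) (norm_nonneg _) |>.2

theorem exists_rep_bound (x : α.Alg) : ∃ C : ℝ, ∀ (B : Type (max u v)) [NonUnitalCStarAlgebra B]
    (π : α.Alg →⋆ₙₐ[ℂ] B), ‖π x‖ ≤ C := by
  induction x using α.alg_induction with
  | h0 => exact ⟨0, fun B _ π => by rw [map_zero, norm_zero]⟩
  | hδ g a => exact ⟨_, fun B _ π => α.norm_rep_δ_le π a⟩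
  | hadd x y hx hy =>
    obtain ⟨C, hC⟩ := hx
    obtain ⟨D, hD⟩ := hy
    exact ⟨C + D, fun B _ π => by
      rw [map_add]
      exact norm_add_le_of_le (hC B π) (hD B π)⟩

theorem bddAbove_repNorms (x : α.Alg) : BddAbove (α.repNorms x) := by
  obtain ⟨C, hC⟩ := α.exists_rep_bound x
  refine ⟨C, ?_⟩
  rintro _ ⟨H, _, _, _, π, rfl⟩
  exact hC _ π

theorem norm_rep_le {H : Type (max u v)} [NormedAddCommGroup H] [InnerProductSpace ℂ H]
    [CompleteSpace H] (π : α.Alg →⋆ₙₐ[ℂ] (H →L[ℂ] H)) (x : α.Alg) : ‖π x‖ ≤ α.maxNorm x :=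
  le_csSup (α.bddAbove_repNorms x) ⟨H, _, _, _, π, rfl⟩

theorem maxNorm_le {x : α.Alg} {C : ℝ} (h : ∀ (H : Type (max u v)) [NormedAddCommGroup H]
    [InnerProductSpace ℂ H] [CompleteSpace H] (π : α.Alg →⋆ₙₐ[ℂ] (H →L[ℂ] H)), ‖π x‖ ≤ C) :
    α.maxNorm x ≤ C := by
  refine csSup_le (α.repNorms_nonempty x) ?_
  rintro _ ⟨H, _, _, _, π, rfl⟩
  exact h H π

theorem maxNorm_nonneg (x : α.Alg) : 0 ≤ α.maxNorm x :=
  (norm_nonneg _).trans (α.norm_rep_le (H := EuclideanSpace ℂ PEmpty.{(max u v) + 1}) 0 x)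

theorem maxNorm_star_le (x : α.Alg) : α.maxNorm (star x) ≤ α.maxNorm x :=
  α.maxNorm_le fun H _ _ _ π => by
    rw [map_star, norm_star]
    exact α.norm_rep_le π x

theorem maxNorm_mul_le (x y : α.Alg) : α.maxNorm (x * y) ≤ α.maxNorm x * α.maxNorm y :=
  α.maxNorm_le fun H _ _ _ π => by
    rw [map_mul]
    exact (norm_mul_le _ _).trans
      (mul_le_mul (α.norm_rep_le π x) (α.norm_rep_le π y) (norm_nonneg _) (α.maxNorm_nonneg x))

theorem maxNorm_mul_self_le (x : α.Alg) :
    α.maxNorm x * α.maxNorm x ≤ α.maxNorm (star x * x) := by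
  have h : α.maxNorm x ≤ √(α.maxNorm (star x * x)) :=
    α.maxNorm_le fun H _ _ _ π => by
      refine Real.le_sqrt_of_sq_le ?_
      rw [sq, ← CStarRing.norm_star_mul_self, ← map_star, ← map_mul]
      exact α.norm_rep_le π _
  calc _ ≤ √(α.maxNorm (star x * x)) * √(α.maxNorm (star x * x)) :=
        mul_self_le_mul_self (α.maxNorm_nonneg x) h
    _ = _ := Real.mul_self_sqrt (α.maxNorm_nonneg _)

/-- The maximal seminorm as an additive group seminorm. -/
def maxSeminorm : AddGroupSeminorm α.Alg where
  toFun := α.maxNorm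
  map_zero' := le_antisymm (α.maxNorm_le fun H _ _ _ π => by rw [map_zero, norm_zero])
    (α.maxNorm_nonneg 0)
  add_le' x y := α.maxNorm_le fun H _ _ _ π => by
    rw [map_add]
    exact norm_add_le_of_le (α.norm_rep_le π x) (α.norm_rep_le π y)
  neg' x := by
    simp only [maxNorm, repNorms, map_neg, norm_neg]

/-- `C₀(X) ⋊_{α,alg} G` with the maximal seminorm. -/
instance : SeminormedAddCommGroup α.Alg := α.maxSeminorm.toSeminormedAddCommGroup

theorem norm_def (x : α.Alg) : ‖x‖ = α.maxNorm x := rfl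

instance : NonUnitalSeminormedRing α.Alg where
  dist_eq _ _ := rfl
  norm_mul_le := α.maxNorm_mul_le

instance : NormedSpace ℂ α.Alg where
  norm_smul_le c x := α.maxNorm_le fun H _ _ _ π => by
    rw [map_smul, norm_smul]
    exact mul_le_mul_of_nonneg_left (α.norm_rep_le π x) (norm_nonneg c)

instance : NormedStarGroup α.Alg where
  norm_star_le := α.maxNorm_star_le

end PartialAction

namespace PartialAction

open UniformSpace UniformSpace.Completion

variable {G : Type v} [AddGroup G] [DecidableEq G] {X : Type u} [TopologicalSpace X] [T2Space X]

/-- The partial crossed product `C₀(X) ⋊_α G`: the completion of `C₀(X) ⋊_{α,alg} G` in the maximal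
seminorm. -/
def CrossedProduct (α : PartialAction G X) : Type max u v := Completion α.Alg

variable (α : PartialAction G X)

instance : NormedAddCommGroup α.CrossedProduct :=
  inferInstanceAs (NormedAddCommGroup (Completion α.Alg))

instance : NormedSpace ℂ α.CrossedProduct := inferInstanceAs (NormedSpace ℂ (Completion α.Alg))

instance : CompleteSpace α.CrossedProduct := inferInstanceAs (CompleteSpace (Completion α.Alg))

/-- The canonical map from the algebraic crossed product. -/
def ι (x : α.Alg) : α.CrossedProduct := (x : Completion α.Alg)

theorem isDenseInducing_ι : IsDenseInducing α.ι := isDenseInducing_coe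

theorem continuous_ι : Continuous α.ι := continuous_coe α.Alg

theorem ι_add (x y : α.Alg) : α.ι (x + y) = α.ι x + α.ι y := coe_add x y

theorem ι_smul (c : ℂ) (x : α.Alg) : α.ι (c • x) = c • α.ι x := coe_smul c x

theorem norm_ι (x : α.Alg) : ‖α.ι x‖ = ‖x‖ := norm_coe x

/-- The canonical map as an additive homomorphism. -/
def ιAdd : α.Alg →+ α.CrossedProduct where
  toFun := α.ι
  map_zero' := coe_zero
  map_add' := α.ι_add

theorem cp_induction {p : α.CrossedProduct → Prop} (x : α.CrossedProduct)
    (hp : IsClosed {x | p x}) (h : ∀ x : α.Alg, p (α.ι x)) : p x :=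
  induction_on x hp h

theorem ι_zero : α.ι 0 = 0 := coe_zero

theorem cp_induction₂ {p : α.CrossedProduct → α.CrossedProduct → Prop} (x y : α.CrossedProduct)
    (hp : IsClosed {x : α.CrossedProduct × α.CrossedProduct | p x.1 x.2})
    (h : ∀ x y : α.Alg, p (α.ι x) (α.ι y)) : p x y :=
  induction_on₂ x y hp h

theorem cp_induction₃ {p : α.CrossedProduct → α.CrossedProduct → α.CrossedProduct → Prop}
    (x y z : α.CrossedProduct)
    (hp : IsClosed {x : α.CrossedProduct × α.CrossedProduct × α.CrossedProduct |
      p x.1 x.2.1 x.2.2})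
    (h : ∀ x y z : α.Alg, p (α.ι x) (α.ι y) (α.ι z)) : p x y z :=
  induction_on₃ x y z hp h

instance : Mul α.CrossedProduct :=
  ⟨fun x y => (α.isDenseInducing_ι.prodMap α.isDenseInducing_ι).extend
    (fun p : α.Alg × α.Alg => α.ι (p.1 * p.2)) (x, y)⟩

theorem ι_mul (x y : α.Alg) : α.ι (x * y) = α.ι x * α.ι y :=
  ((α.isDenseInducing_ι.prodMap α.isDenseInducing_ι).extend_eq
    (α.continuous_ι.comp continuous_mul) (x, y)).symm

instance : ContinuousMul α.CrossedProduct where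
  continuous_mul := by
    let m := (AddMonoidHom.mul : α.Alg →+ α.Alg →+ α.Alg).compr₂ α.ιAdd
    have : Continuous fun p : α.Alg × α.Alg => m p.1 p.2 := α.continuous_ι.comp continuous_mul
    have di : IsDenseInducing α.ιAdd := α.isDenseInducing_ι
    exact (di.extend_Z_bilin di this :)

instance : Star α.CrossedProduct := ⟨Completion.map (star : α.Alg → α.Alg)⟩

theorem ι_star (x : α.Alg) : α.ι (star x) = star (α.ι x) :=
  (map_coe (starₗᵢ (E := α.Alg) ℂ).isometry.uniformContinuous x).symm

instance : ContinuousStar α.CrossedProduct := ⟨continuous_map⟩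

theorem cp_zero_mul (x : α.CrossedProduct) : 0 * x = 0 := by
  induction x using α.cp_induction with
  | hp => exact isClosed_eq (continuous_const.mul continuous_id) continuous_const
  | h x => rw [← α.ι_zero, ← ι_mul, zero_mul]

theorem cp_mul_zero (x : α.CrossedProduct) : x * 0 = 0 := by
  induction x using α.cp_induction with
  | hp => exact isClosed_eq (continuous_id.mul continuous_const) continuous_const
  | h x => rw [← α.ι_zero, ← ι_mul, mul_zero]

theorem cp_mul_add (x y z : α.CrossedProduct) : x * (y + z) = x * y + x * z := by
  refine α.cp_induction₃ (p := fun x y z => x * (y + z) = x * y + x * z) x y z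
    (isClosed_eq ?_ ?_) fun x y z => ?_
  · exact continuous_fst.mul (continuous_snd.fst.add continuous_snd.snd)
  · exact (continuous_fst.mul continuous_snd.fst).add (continuous_fst.mul continuous_snd.snd)
  · simp only [← ι_mul, ← ι_add, mul_add]

theorem cp_add_mul (x y z : α.CrossedProduct) : (x + y) * z = x * z + y * z := by
  refine α.cp_induction₃ (p := fun x y z => (x + y) * z = x * z + y * z) x y z
    (isClosed_eq ?_ ?_) fun x y z => ?_
  · exact (continuous_fst.add continuous_snd.fst).mul continuous_snd.snd
  · exact (continuous_fst.mul continuous_snd.snd).add (continuous_snd.fst.mul continuous_snd.snd)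
  · simp only [← ι_mul, ← ι_add, add_mul]

theorem cp_mul_assoc (x y z : α.CrossedProduct) : x * y * z = x * (y * z) := by
  refine α.cp_induction₃ (p := fun x y z => x * y * z = x * (y * z)) x y z
    (isClosed_eq ?_ ?_) fun x y z => ?_
  · exact (continuous_fst.mul continuous_snd.fst).mul continuous_snd.snd
  · exact continuous_fst.mul (continuous_snd.fst.mul continuous_snd.snd)
  · simp only [← ι_mul, mul_assoc]

theorem cp_norm_mul_le (x y : α.CrossedProduct) : ‖x * y‖ ≤ ‖x‖ * ‖y‖ := by
  refine α.cp_induction₂ (p := fun x y => ‖x * y‖ ≤ ‖x‖ * ‖y‖) x y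
    (isClosed_le ?_ ?_) fun x y => ?_
  · exact (continuous_fst.mul continuous_snd).norm
  · exact continuous_fst.norm.mul continuous_snd.norm
  · rw [← ι_mul, norm_ι, norm_ι, norm_ι]
    exact norm_mul_le x y

theorem cp_star_star (x : α.CrossedProduct) : star (star x) = x := by
  induction x using α.cp_induction with
  | hp => exact isClosed_eq continuous_star.star continuous_id
  | h x => rw [← ι_star, ← ι_star, star_star]

theorem cp_star_add (x y : α.CrossedProduct) : star (x + y) = star x + star y := by
  refine α.cp_induction₂ (p := fun x y => star (x + y) = star x + star y) x y
    (isClosed_eq ?_ ?_) fun x y => ?_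
  · exact (continuous_fst.add continuous_snd).star
  · exact continuous_fst.star.add continuous_snd.star
  · simp only [← ι_star, ← ι_add, star_add]

theorem cp_star_mul (x y : α.CrossedProduct) : star (x * y) = star y * star x := by
  refine α.cp_induction₂ (p := fun x y => star (x * y) = star y * star x) x y
    (isClosed_eq ?_ ?_) fun x y => ?_
  · exact (continuous_fst.mul continuous_snd).star
  · exact continuous_snd.star.mul continuous_fst.star
  · simp only [← ι_star, ← ι_mul, star_mul]

theorem cp_norm_mul_self_le (x : α.CrossedProduct) : ‖x‖ * ‖x‖ ≤ ‖star x * x‖ := by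
  induction x using α.cp_induction with
  | hp =>
    refine isClosed_le ?_ ?_
    · exact continuous_norm.mul continuous_norm
    · exact (continuous_star.mul continuous_id).norm
  | h x =>
    rw [← ι_star, ← ι_mul, norm_ι, norm_ι]
    exact α.maxNorm_mul_self_le x

theorem cp_smul_mul (c : ℂ) (x y : α.CrossedProduct) : (c • x) * y = c • (x * y) := by
  refine α.cp_induction₂ (p := fun x y => (c • x) * y = c • (x * y)) x y
    (isClosed_eq ?_ ?_) fun x y => ?_
  · exact (continuous_fst.const_smul c).mul continuous_snd
  · exact (continuous_fst.mul continuous_snd).const_smul c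
  · simp only [← ι_smul, ← ι_mul, smul_mul_assoc]

theorem cp_mul_smul (c : ℂ) (x y : α.CrossedProduct) : x * (c • y) = c • (x * y) := by
  refine α.cp_induction₂ (p := fun x y => x * (c • y) = c • (x * y)) x y
    (isClosed_eq ?_ ?_) fun x y => ?_
  · exact continuous_fst.mul (continuous_snd.const_smul c)
  · exact (continuous_fst.mul continuous_snd).const_smul c
  · simp only [← ι_smul, ← ι_mul, mul_smul_comm]

theorem cp_star_smul (c : ℂ) (x : α.CrossedProduct) : star (c • x) = star c • star x := by
  induction x using α.cp_induction with
  | hp => exact isClosed_eq (continuous_id.const_smul c).star (continuous_star.const_smul (star c))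
  | h x => simp only [← ι_star, ← ι_smul, star_smul]

instance : NonUnitalNormedRing α.CrossedProduct where
  __ := (inferInstance : NormedAddCommGroup α.CrossedProduct)
  zero_mul := α.cp_zero_mul
  mul_zero := α.cp_mul_zero
  left_distrib := α.cp_mul_add
  right_distrib := α.cp_add_mul
  mul_assoc := α.cp_mul_assoc
  norm_mul_le := α.cp_norm_mul_le

instance : StarRing α.CrossedProduct where
  star_involutive := α.cp_star_star
  star_add := α.cp_star_add
  star_mul := α.cp_star_mul

/-- The partial crossed product is a C*-algebra. -/
instance : NonUnitalCStarAlgebra α.CrossedProduct where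
  __ := (inferInstance : NormedSpace ℂ α.CrossedProduct)
  norm_mul_self_le := α.cp_norm_mul_self_le
  smul_assoc := α.cp_smul_mul
  smul_comm c x y := (α.cp_mul_smul c x y).symm
  star_smul := α.cp_star_smul

end PartialAction

namespace PartialAction.IsRestriction

open UniformSpace UniformSpace.Completion

variable {G : Type v} [AddGroup G] {X : Type u} [TopologicalSpace X]
  {α β : PartialAction G X}

theorem dom_subset (h : α.IsRestriction β) (g : G) : α.dom g ⊆ β.dom g := fun _ hy => by
  obtain ⟨x, hx⟩ := α.exists_rel_of_mem hy
  exact β.mem_of_rel ((h g).rel hx)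

/-- The inclusion `C₀(D g) ⊆ C₀(D' g)` for a restriction `α` of `β`. -/
def coeffIncl (h : α.IsRestriction β) (g : G) : ideal (α.dom g) →ₗ[ℂ] ideal (β.dom g) :=
  Submodule.inclusion fun _ hf x hx => hf x fun hx' => hx (h.dom_subset g hx')

variable [DecidableEq G]

/-- The inclusion of algebraic crossed products, `a δ_g ↦ a δ_g`, as a linear map. -/
def algInclₗ (h : α.IsRestriction β) : α.Alg →ₗ[ℂ] β.Alg :=
  α.lift fun g => (β.δ g).comp (h.coeffIncl g)

theorem algInclₗ_δ (h : α.IsRestriction β) {g : G} (a : ideal (α.dom g)) :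
    h.algInclₗ (α.δ g a) = β.δ g (h.coeffIncl g a) :=
  α.lift_δ _ g a

variable [T2Space X]

/-- The inclusion of algebraic crossed products, `a δ_g ↦ a δ_g`, for a restriction `α` of `β`. -/
def algIncl (h : α.IsRestriction β) : α.Alg →⋆ₙₐ[ℂ] β.Alg where
  toFun := h.algInclₗ
  map_smul' c x := h.algInclₗ.map_smul c x
  map_zero' := h.algInclₗ.map_zero
  map_add' := h.algInclₗ.map_add
  map_mul' x y := by
    induction x using α.alg_induction with
    | h0 => simp
    | hadd x x' hx hx' => simp only [add_mul, map_add, hx, hx']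
    | hδ g a =>
      induction y using α.alg_induction with
      | h0 => simp
      | hadd y y' hy hy' => simp only [mul_add, map_add, hy, hy']
      | hδ k b =>
        rw [δ_mul_δ, algInclₗ_δ, algInclₗ_δ, algInclₗ_δ, δ_mul_δ]
        refine β.δ_congr rfl fun y => ?_
        change (α.coeffMul a b).1 y = _
        by_cases hy : y ∈ α.dom g
        · obtain ⟨x, hx⟩ := α.exists_rel_of_mem hy
          rw [α.coeffMul_of_rel _ _ hx, β.coeffMul_of_rel _ _ ((h g).rel hx)]
          rfl
        · rw [α.coeffMul_of_notMem _ _ hy]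
          by_cases hy' : y ∈ β.dom g
          · obtain ⟨x, hx⟩ := β.exists_rel_of_mem hy'
            rw [β.coeffMul_of_rel _ _ hx]
            change 0 = a.1 y * b.1 x
            rw [α.coe_eq_zero a hy, zero_mul]
          · rw [β.coeffMul_of_notMem _ _ hy']
  map_star' x := by
    induction x using α.alg_induction with
    | h0 => simp
    | hadd x x' hx hx' => simp only [star_add, map_add, hx, hx']
    | hδ g a =>
      rw [star_δ, algInclₗ_δ, algInclₗ_δ, star_δ]
      refine β.δ_congr rfl fun x => ?_
      change (α.coeffStar a).1 x = _
      refine (β.coeffStar_apply_eq _ _ _ (fun y hy => ?_) fun hx => ?_).symm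
      · change _ = star (a.1 y)
        refine α.coeffStar_apply_eq _ _ _ (fun z hz => ?_) fun hx => ?_
        · rw [← hy.2, ((h g).rel hz).2]
        · by_cases hya : y ∈ α.dom g
          · obtain ⟨z, hz⟩ := α.exists_rel_of_mem hya
            obtain rfl : z = x := (β.map g).injOn ((h g).rel hz).1 hy.1
              (((h g).rel hz).2.trans hy.2.symm)
            exact absurd (α.mem_of_rel (α.rel_neg hz)) hx
          · rw [α.coe_eq_zero a hya, star_zero]
      · exact α.coeffStar_of_notMem a fun hx' => hx (h.dom_subset _ hx')

theorem norm_algIncl_le (h : α.IsRestriction β) (x : α.Alg) : ‖h.algIncl x‖ ≤ ‖x‖ :=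
  β.maxNorm_le fun _ _ _ _ π => α.norm_rep_le (π.comp h.algIncl) x

theorem uniformContinuous_algIncl (h : α.IsRestriction β) : UniformContinuous h.algIncl :=
  (AddMonoidHomClass.lipschitz_of_bound h.algIncl 1
    fun x => by rw [one_mul]; exact h.norm_algIncl_le x).uniformContinuous

/-- The underlying function of the canonical map of crossed products. -/
def cpMapFun (h : α.IsRestriction β) : α.CrossedProduct → β.CrossedProduct :=
  Completion.map h.algIncl

theorem continuous_cpMapFun (h : α.IsRestriction β) : Continuous h.cpMapFun := continuous_map

theorem cpMapFun_ι (h : α.IsRestriction β) (x : α.Alg) :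
    h.cpMapFun (α.ι x) = β.ι (h.algIncl x) :=
  map_coe h.uniformContinuous_algIncl x

theorem cpMapFun_smul (h : α.IsRestriction β) (c : ℂ) (x : α.CrossedProduct) :
    h.cpMapFun (c • x) = c • h.cpMapFun x := by
  have hc := h.continuous_cpMapFun
  induction x using α.cp_induction with
  | hp => exact isClosed_eq (hc.comp (continuous_id.const_smul c)) (hc.const_smul c)
  | h x => rw [← ι_smul, cpMapFun_ι, cpMapFun_ι, map_smul, ι_smul]

theorem cpMapFun_add (h : α.IsRestriction β) (x y : α.CrossedProduct) :
    h.cpMapFun (x + y) = h.cpMapFun x + h.cpMapFun y := by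
  have hc := h.continuous_cpMapFun
  refine α.cp_induction₂ (p := fun x y => h.cpMapFun (x + y) = h.cpMapFun x + h.cpMapFun y) x y
    (isClosed_eq ?_ ?_) fun x y => ?_
  · exact hc.comp (continuous_fst.add continuous_snd)
  · exact (hc.comp continuous_fst).add (hc.comp continuous_snd)
  · rw [← ι_add, cpMapFun_ι, cpMapFun_ι, cpMapFun_ι, map_add, ι_add]

theorem cpMapFun_mul (h : α.IsRestriction β) (x y : α.CrossedProduct) :
    h.cpMapFun (x * y) = h.cpMapFun x * h.cpMapFun y := by
  have hc := h.continuous_cpMapFun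
  refine α.cp_induction₂ (p := fun x y => h.cpMapFun (x * y) = h.cpMapFun x * h.cpMapFun y) x y
    (isClosed_eq ?_ ?_) fun x y => ?_
  · exact hc.comp (continuous_fst.mul continuous_snd)
  · exact (hc.comp continuous_fst).mul (hc.comp continuous_snd)
  · rw [← ι_mul, cpMapFun_ι, cpMapFun_ι, cpMapFun_ι, map_mul, ι_mul]

theorem cpMapFun_star (h : α.IsRestriction β) (x : α.CrossedProduct) :
    h.cpMapFun (star x) = star (h.cpMapFun x) := by
  have hc := h.continuous_cpMapFun
  induction x using α.cp_induction with
  | hp => exact isClosed_eq (hc.comp continuous_star) hc.star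
  | h x => rw [← ι_star, cpMapFun_ι, cpMapFun_ι, map_star, ι_star]

/-- The canonical `*`-homomorphism `C₀(X) ⋊_α G → C₀(X) ⋊_β G` for a restriction `α` of `β`,
the continuous extension of the inclusion `a δ_g ↦ a δ_g`. -/
def cpMap (h : α.IsRestriction β) : α.CrossedProduct →⋆ₙₐ[ℂ] β.CrossedProduct where
  toFun := h.cpMapFun
  map_smul' := h.cpMapFun_smul
  map_zero' := by
    have := h.cpMapFun_ι 0
    rw [map_zero, α.ι_zero, β.ι_zero] at this
    exact this
  map_add' := h.cpMapFun_add
  map_mul' := h.cpMapFun_mul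
  map_star' := h.cpMapFun_star

theorem cpMap_ι (h : α.IsRestriction β) (x : α.Alg) : h.cpMap (α.ι x) = β.ι (h.algIncl x) :=
  h.cpMapFun_ι x

end PartialAction.IsRestriction

/-- `L` with the maps `μ i : A i → L` is the inductive limit, in the category of C*-algebras and
`*`-homomorphisms, of the inductive sequence `A 0 → A 1 → ⋯` with connecting maps
`φ i j : A i → A j` for `i ≤ j`. -/
structure IsInductiveLimit {A : ℕ → Type u} [∀ i, NonUnitalCStarAlgebra (A i)]
    (φ : ∀ i j, i ≤ j → A i →⋆ₙₐ[ℂ] A j) {L : Type u} [NonUnitalCStarAlgebra L]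
    (μ : ∀ i, A i →⋆ₙₐ[ℂ] L) : Prop where
  map_self : ∀ i x, φ i i le_rfl x = x
  map_map : ∀ i j k (hij : i ≤ j) (hjk : j ≤ k) x,
    φ j k hjk (φ i j hij x) = φ i k (hij.trans hjk) x
  compatible : ∀ i j (hij : i ≤ j) x, μ j (φ i j hij x) = μ i x
  universal : ∀ (B : Type u) [NonUnitalCStarAlgebra B] (ψ : ∀ i, A i →⋆ₙₐ[ℂ] B),
    (∀ i j (hij : i ≤ j) x, ψ j (φ i j hij x) = ψ i x) →
    ∃! Ψ : L →⋆ₙₐ[ℂ] B, ∀ i x, Ψ (μ i x) = ψ i x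

end PartialDynamics

end

/-! Cut `θ` down to relatively compact regular open sets `W i` that exhaust its domain and whose
closures stay inside it. A homeomorphism between open sets need not preserve regular openness, since
boundary points may lie outside its domain. It does so for sets whose closure is compact and
contained in the domain (`IsRegularOpen.image`). Each domain of a power of `θ|W` arises from the
whole space by repeatedly intersecting with `W` and applying `θ`, or intersecting with `θ(W)` and
applying `θ⁻¹`, so all these domains are regular open (`isRegularOpen_generated_dom`).

For the limit, a point of `D n` has a finite orbit segment witnessing this, and that segment lies in
a single `W i` from some index on. Hence `D n` is the increasing union of the `D n` of the
restrictions (`exists_mem_generated_dom`), and every `f ∈ C₀(D n)` is a uniform limit of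
coefficients of the restrictions (`exists_tendsto_ideal`). Any `*`-homomorphism satisfies `‖π (a
δ_g)‖ ≤ ‖a‖`. So compatible `*`-homomorphisms on the smaller algebras converge along such sequences,
and the limits define a `*`-homomorphism on the large algebraic crossed product (`exists_algHom`).
The same estimate gives density of the images, hence uniqueness (`hom_ext_of_dom_subset`).
Injectivity of the connecting maps plays no role.

The maximal norm is a supremum over Hilbert space representations, while the universal property
concerns arbitrary C*-algebras `B`. The two are linked by the GNS construction: each `b` in `B` is
normed by some representation (`NonUnitalCStarAlgebra.exists_norm_le_rep`), so every
`*`-homomorphism into `B` is dominated by the maximal norm and extends to the completion. -/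

noncomputable section

/-! ### States and the GNS construction. -/

section GelfandNaimark

universe w

open scoped ComplexOrder ComplexStarModule

/-- The order bound `1 + h ≤ ‖1 + h‖` gives `h ≤ ‖1 + h‖ - 1`, which bounds `‖h‖`. The equality
forces a functional norming `1 + h` to norm both summands, and this is how a state is found. -/
theorem CStarAlgebra.norm_one_add_of_nonneg {A : Type*} [CStarAlgebra A] [Nontrivial A]
    [PartialOrder A] [StarOrderedRing A] {h : A} (hh : 0 ≤ h) : ‖1 + h‖ = 1 + ‖h‖ := by
  have h1 : (0 : A) ≤ 1 := zero_le_one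
  have hsum : 0 ≤ 1 + h := add_nonneg h1 hh
  have hone : 1 ≤ ‖1 + h‖ := by
    have := CStarAlgebra.norm_le_norm_of_nonneg_of_le h1 (le_add_of_nonneg_right hh)
    rwa [CStarRing.norm_one] at this
  refine le_antisymm ((norm_add_le _ _).trans (by rw [CStarRing.norm_one])) ?_
  have h2 : h ≤ algebraMap ℝ A (‖1 + h‖ - 1) := by
    have := IsSelfAdjoint.le_algebraMap_norm_self (.of_nonneg hsum)
    rw [map_sub, map_one]
    exact le_sub_iff_add_le'.2 this
  have := (CStarAlgebra.norm_le_iff_le_algebraMap h (by linarith)).2 h2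
  linarith

/-- A real functional of norm one with value one at the unit is positive. -/
theorem CStarAlgebra.nonneg_of_norm_le_one {A : Type*} [CStarAlgebra A] [PartialOrder A]
    [StarOrderedRing A] (g : StrongDual ℝ A) (hg : ‖g‖ ≤ 1) (hg1 : g 1 = 1) {x : A}
    (hx : 0 ≤ x) : 0 ≤ g x := by
  -- Since `0 ≤ ‖x‖ - x ≤ ‖x‖`, applying `g` gives `‖x‖ - g x ≤ ‖x‖`.
  have h1 : ‖algebraMap ℝ A ‖x‖ - x‖ ≤ ‖x‖ := by
    refine (CStarAlgebra.norm_le_iff_le_algebraMap _ (norm_nonneg x) ?_).2 (sub_le_self _ hx)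
    exact sub_nonneg.2 (IsSelfAdjoint.le_algebraMap_norm_self (.of_nonneg hx))
  have h2 : g (algebraMap ℝ A ‖x‖ - x) ≤ ‖x‖ :=
    (le_abs_self _).trans ((g.le_of_opNorm_le hg _).trans (by rwa [one_mul]))
  rw [map_sub, Algebra.algebraMap_eq_smul_one, map_smul, hg1, smul_eq_mul, mul_one] at h2
  linarith

/-- For every `a` there is a state with value `‖a‖ ^ 2` at `star a * a`. -/
theorem CStarAlgebra.exists_state {A : Type*} [CStarAlgebra A] [Nontrivial A] [PartialOrder A]
    [StarOrderedRing A] (a : A) :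
    ∃ f : A →ₚ[ℂ] ℂ, f 1 = 1 ∧ f (star a * a) = (‖a‖ ^ 2 : ℝ) := by
  have hh : 0 ≤ star a * a := star_mul_self_nonneg a
  have hn := CStarAlgebra.norm_one_add_of_nonneg hh
  obtain ⟨g, hg, hgv⟩ := exists_dual_vector ℝ (1 + star a * a) (by
    rw [hn]; positivity)
  have hle : ∀ x, g x ≤ ‖x‖ := fun x =>
    (le_abs_self _).trans ((g.le_of_opNorm_le hg.le _).trans (by rw [one_mul]))
  have e1 := hle 1
  have e2 := hle (star a * a)
  rw [map_add, hn] at hgv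
  rw [CStarRing.norm_one] at e1
  simp only [RCLike.ofReal_real_eq_id, id_eq] at hgv
  -- The upper bounds `e1` and `e2` add up to the value in `hgv`, so both are equalities.
  have hg1 : g 1 = 1 := by linarith
  have hg2 : g (star a * a) = ‖a‖ ^ 2 := by
    rw [sq, ← CStarRing.norm_star_mul_self]; linarith
  have hre : ∀ x : A, IsSelfAdjoint x → (ℜ x : A) = x := fun x hx => hx.coe_realPart
  have him : ∀ x : A, IsSelfAdjoint x → (ℑ x : A) = 0 := fun x hx => by
    rw [hx.imaginaryPart]; rfl
  -- Only the values of the real functional `g` on self-adjoint elements are kept; they extend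
  -- uniquely to a complex-linear functional.
  let F : A →ₗ[ℂ] ℂ :=
    { toFun := fun x => g (ℜ x : A) + g (ℑ x : A) * Complex.I
      map_add' := fun x y => by
        simp only [map_add, AddSubgroup.coe_add, Complex.ofReal_add]
        ring
      map_smul' := fun c x => by
        rw [realPart_smul, imaginaryPart_smul]
        simp only [AddSubgroup.coe_add, AddSubgroup.coe_sub, selfAdjoint.val_smul, map_add, map_sub,
          map_smul, smul_eq_mul, RingHom.id_apply]
        apply Complex.ext <;> simp }
  have hF : ∀ x : A, IsSelfAdjoint x → F x = g x := fun x hx => by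
    change (g (ℜ x : A) : ℂ) + g (ℑ x : A) * Complex.I = g x
    rw [hre x hx, him x hx, map_zero, Complex.ofReal_zero, zero_mul, add_zero]
  refine ⟨PositiveLinearMap.mk₀ F fun x hx => ?_, ?_, ?_⟩
  · rw [hF x (.of_nonneg hx)]
    exact Complex.zero_le_real.2 (CStarAlgebra.nonneg_of_norm_le_one g hg.le hg1 hx)
  · change F 1 = 1
    rw [hF 1 (.one A), hg1, Complex.ofReal_one]
  · change F (star a * a) = _
    rw [hF _ (.star_mul_self a), hg2]

/-- The norm of an element of a C*-algebra is attained in a representation on a Hilbert space. -/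
theorem NonUnitalCStarAlgebra.exists_norm_le_rep {B : Type w} [NonUnitalCStarAlgebra B] (b : B) :
    ∃ (H : Type w) (_ : NormedAddCommGroup H) (_ : InnerProductSpace ℂ H) (_ : CompleteSpace H)
      (π : B →⋆ₙₐ[ℂ] (H →L[ℂ] H)), ‖b‖ ≤ ‖π b‖ := by
  -- Adjoining a unit is isometric on `B` and provides the class of `1` as a unit vector in the GNS
  -- space.
  let A := Unitization ℂ B
  let _ : PartialOrder A := CStarAlgebra.spectralOrder A
  have _ : StarOrderedRing A := CStarAlgebra.spectralOrderedRing A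
  obtain ⟨f, hf1, hf⟩ := CStarAlgebra.exists_state (b : A)
  refine ⟨f.GNS, inferInstance, inferInstance, inferInstance,
    f.gnsNonUnitalStarAlgHom.comp (Unitization.inrNonUnitalStarAlgHom ℂ B), ?_⟩
  have key : ∀ x : A, ‖((f.toPreGNS x : f.PreGNS) : f.GNS)‖ ^ 2 = (f (star x * x)).re := by
    intro x
    have := f.preGNS_norm_sq (f.toPreGNS x)
    rw [UniformSpace.Completion.norm_coe]
    rw [f.ofPreGNS_toPreGNS] at this
    rw [← this]
    norm_cast
  have h1 : ‖((f.toPreGNS 1 : f.PreGNS) : f.GNS)‖ = 1 := by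
    rw [← sq_eq_sq₀ (norm_nonneg _) zero_le_one, key, star_one, one_mul, hf1]
    simp
  -- Applied to the class of `1`, the operator of `b` gives the class of `b`, whose squared norm is
  -- `f (star b * b) = ‖b‖ ^ 2`.
  have h2 := (f.gnsNonUnitalStarAlgHom (b : A)).le_opNorm ((f.toPreGNS 1 : f.PreGNS) : f.GNS)
  rw [h1, mul_one, f.gnsNonUnitalStarAlgHom_apply_coe] at h2
  refine le_trans (le_of_eq ?_) h2
  rw [← sq_eq_sq₀ (norm_nonneg _) (norm_nonneg _)]
  rw [f.leftMulMapPreGNS_apply, f.ofPreGNS_toPreGNS, mul_one]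
  refine Eq.trans ?_ (key _).symm
  rw [hf, Complex.ofReal_re, Unitization.norm_inr]

end GelfandNaimark

namespace PartialDynamics

/-! ### Regular open sets, their images and exhaustions. -/

section RegularOpen

variable {X : Type*} [TopologicalSpace X]

theorem isRegularOpen_univ : IsRegularOpen (univ : Set X) := by simp [IsRegularOpen]

theorem IsRegularOpen.isOpen {U : Set X} (h : IsRegularOpen U) : IsOpen U := by
  rw [← h]
  exact isOpen_interior

theorem IsRegularOpen.inter {U V : Set X} (hU : IsRegularOpen U) (hV : IsRegularOpen V) :
    IsRegularOpen (U ∩ V) := by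
  refine Subset.antisymm (subset_inter ?_ ?_)
    (interior_maximal subset_closure (hU.isOpen.inter hV.isOpen))
  · exact (interior_mono (closure_mono inter_subset_left)).trans_eq hU
  · exact (interior_mono (closure_mono inter_subset_right)).trans_eq hV

theorem isRegularOpen_interior {K : Set X} (hK : IsClosed K) : IsRegularOpen (interior K) :=
  Subset.antisymm (interior_mono (closure_minimal interior_subset hK))
    (interior_maximal subset_closure isOpen_interior)

variable [T2Space X]

/-- The image of the compact closure is compact, hence closed in a Hausdorff space; no limit points
appear outside the range. -/
theorem closure_image_eq {e : OpenPartialHomeomorph X X} {W : Set X}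
    (hc : IsCompact (closure W)) (hs : closure W ⊆ e.source) :
    closure (e '' W) = e '' closure W := by
  have h := e.continuousOn.mono hs
  exact Subset.antisymm
    (closure_minimal (image_mono subset_closure) (hc.image_of_continuousOn h).isClosed)
    h.image_closure

/-- The closure of the image is the image of the closure, and a homeomorphism between open sets
transports interiors, so the identity `interior (closure W) = W` carries over. -/
theorem IsRegularOpen.image {e : OpenPartialHomeomorph X X} {W : Set X} (hW : IsRegularOpen W)
    (hc : IsCompact (closure W)) (hs : closure W ⊆ e.source) : IsRegularOpen (e '' W) := by
  refine Subset.antisymm ?_ (interior_maximal subset_closure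
    (e.isOpen_image_of_subset_source hW.isOpen (subset_closure.trans hs)))
  rw [closure_image_eq hc hs]
  have himg : e.IsImage (closure W) (e '' closure W) := by
    intro x hx
    constructor
    · rintro ⟨y, hy, hyx⟩
      rwa [← e.injOn (hs hy) hx hyx]
    · exact fun h => ⟨x, h, rfl⟩
  intro y hy
  obtain ⟨x, hx, rfl⟩ := interior_subset hy
  have := (himg.interior (hs hx)).1 hy
  rw [hW] at this
  exact ⟨x, this, rfl⟩

/-- An open subset of a locally compact second countable space is exhausted by an increasing
sequence of relatively compact regular open sets. -/
theorem exists_regularOpen_exhaustion [LocallyCompactSpace X] [SecondCountableTopology X]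
    {U : Set X} (hU : IsOpen U) : ∃ W : ℕ → Set X, Monotone W ∧ (∀ i, IsRegularOpen (W i)) ∧
      (∀ i, IsCompact (closure (W i))) ∧ (∀ i, closure (W i) ⊆ U) ∧ U = ⋃ i, W i := by
  have : LocallyCompactSpace U := hU.locallyCompactSpace
  obtain ⟨K⟩ : Nonempty (CompactExhaustion U) := ⟨default⟩
  obtain ⟨C, hC⟩ : ∃ C : ℕ → Set X, ∀ i, C i = Subtype.val '' K i := ⟨_, fun _ => rfl⟩
  have hK : ∀ i, IsCompact (C i) := fun i => by
    rw [hC]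
    exact (K.isCompact i).image continuous_subtype_val
  have hcl : ∀ i, closure (interior (C i)) ⊆ C i := fun i =>
    closure_minimal interior_subset (hK i).isClosed
  have hsub : ∀ i, C i ⊆ U := fun i => by
    rw [hC]
    exact Subtype.coe_image_subset U _
  refine ⟨fun i => interior (C i), fun i j hij => interior_mono ?_,
    fun i => isRegularOpen_interior (hK i).isClosed,
    fun i => (hK i).of_isClosed_subset isClosed_closure (hcl i), fun i => (hcl i).trans (hsub i),
    Subset.antisymm (fun x hx => ?_) (iUnion_subset fun i => interior_subset.trans (hsub i))⟩
  · rw [hC, hC]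
    exact image_mono (K.subset hij)
  · have hx' : (⟨x, hx⟩ : U) ∈ ⋃ i, K i := by rw [K.iUnion_eq]; trivial
    obtain ⟨i, hi⟩ := mem_iUnion.1 hx'
    -- A point of `K i` may lie on its boundary but is interior to `K (i + 1)`. Interiors in `U` are
    -- open in `X` because `U` is open.
    refine mem_iUnion.2 ⟨i + 1, ?_⟩
    have h1 : Subtype.val '' interior (K (i + 1)) ⊆ interior (C (i + 1)) := by
      rw [hC]
      exact interior_maximal (image_mono interior_subset)
        (hU.isOpenMap_subtype_val _ isOpen_interior)
    exact h1 ⟨_, K.subset_interior_succ i hi, rfl⟩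

end RegularOpen

/-! ### Domains of the powers of a restricted partial homeomorphism. -/

section Restriction

variable {X : Type*} [TopologicalSpace X]

theorem rel_restrOpen {θ : OpenPartialHomeomorph X X} {W : Set X} (hW : IsOpen W) {x y : X} :
    Rel (θ.restrOpen W hW) x y ↔ x ∈ W ∧ Rel θ x y := by
  simp only [Rel, OpenPartialHomeomorph.restrOpen_source, mem_inter_iff,
    show ∀ z, θ.restrOpen W hW z = θ z from fun _ => rfl]
  tauto

theorem mem_source_iff {e : OpenPartialHomeomorph X X} {x : X} : x ∈ e.source ↔ ∃ y, Rel e x y :=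
  ⟨fun h => ⟨_, h, rfl⟩, fun ⟨_, h⟩ => h.1⟩

theorem mem_target_iff {e : OpenPartialHomeomorph X X} {y : X} : y ∈ e.target ↔ ∃ x, Rel e x y := by
  rw [← e.symm_source, mem_source_iff]
  simp only [rel_symm]

/-- Only finitely many points of an orbit are involved in defining a power at `x`, and monotonicity
puts them all in one domain. -/
theorem exists_mem_generated_dom {θ : OpenPartialHomeomorph X X}
    {θs : ℕ → OpenPartialHomeomorph X X} (hmono : ∀ i j, i ≤ j → IsRestriction (θs i) (θs j))
    (hres : ∀ i, IsRestriction (θs i) θ) (hU : θ.source = ⋃ i, (θs i).source) {n : ℤ} {x : X}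
    (hx : x ∈ (generated θ).dom n) : ∃ i, x ∈ (generated (θs i)).dom n := by
  have key : ∀ (k : ℕ) {x y : X}, Rel (natPow θ k) x y → ∃ i, Rel (natPow (θs i) k) x y := by
    intro k
    induction k with
    | zero => exact fun h => ⟨0, h⟩
    | succ k ih =>
      intro x z h
      obtain ⟨y, h1, h2⟩ := rel_trans.1 h
      obtain ⟨i, hi⟩ := ih h1
      obtain ⟨j, hj⟩ := mem_iUnion.1 (hU ▸ h2.1)
      refine ⟨max i j, rel_trans.2 ⟨y, (hmono i _ (le_max_left i j)).natPow k hi,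
        (hmono j _ (le_max_right i j)).rel ⟨hj, ?_⟩⟩⟩
      rw [← ((hres j) y hj).2, h2.2]
  change x ∈ (zPow θ (-n)).source at hx
  change ∃ i, x ∈ (zPow (θs i) (-n)).source
  -- A negative power is the inverse of a positive one, so its domain is read as a range, to which
  -- `key` applies from the other end.
  generalize -n = m at hx ⊢
  rcases m with k | k
  · obtain ⟨i, hi⟩ := key k ⟨hx, rfl⟩
    exact ⟨i, hi.1⟩
  · obtain ⟨y, hy⟩ := mem_target_iff.1 hx
    obtain ⟨i, hi⟩ := key (k + 1) hy
    exact ⟨i, mem_target_iff.2 ⟨y, hi⟩⟩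

variable [T2Space X]

/-- The partial action generated by the restriction of `θ` to a relatively compact regular open
subset has regular open domains. -/
theorem isRegularOpen_generated_dom {θ : OpenPartialHomeomorph X X} {W : Set X}
    (hW : IsRegularOpen W) (hc : IsCompact (closure W)) (hs : closure W ⊆ θ.source) (n : ℤ) :
    IsRegularOpen ((generated (θ.restrOpen W hW.isOpen)).dom n) := by
  have hsW : W ⊆ θ.source := subset_closure.trans hs
  have hθW : IsRegularOpen (θ '' W) := hW.image hc hs
  have hθc : closure (θ '' W) = θ '' closure W := closure_image_eq hc hs
  have hcompact : IsCompact (closure (θ '' W)) := by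
    rw [hθc]
    exact hc.image_of_continuousOn (θ.continuousOn.mono hs)
  have hsub : closure (θ '' W) ⊆ θ.symm.source := by
    rw [hθc, θ.symm_source]
    rintro _ ⟨x, hx, rfl⟩
    exact θ.map_source (hs hx)
  have hsource : ∀ k : ℕ, IsRegularOpen (natPow (θ.restrOpen W hW.isOpen) k).source := by
    intro k
    induction k with
    | zero => exact isRegularOpen_univ
    | succ k ih =>
      -- Here the first application of `θ` is peeled off; for ranges below, it is the last.
      have : (natPow (θ.restrOpen W hW.isOpen) (k + 1)).source =
          θ.symm '' (θ '' W ∩ (natPow (θ.restrOpen W hW.isOpen) k).source) := by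
        ext x
        simp only [mem_source_iff, rel_natPow_succ', rel_restrOpen]
        constructor
        · rintro ⟨z, y, ⟨hx, h, rfl⟩, hz⟩
          exact ⟨θ x, ⟨⟨x, hx, rfl⟩, hz.1⟩, θ.left_inv h⟩
        · rintro ⟨_, ⟨⟨w, hw, rfl⟩, h⟩, rfl⟩
          rw [θ.left_inv (hsW hw)]
          exact ⟨_, _, ⟨hw, hsW hw, rfl⟩, h, rfl⟩
      rw [this]
      -- The intersection inherits a compact closure inside the domain of `θ.symm` from `θ '' W`
      -- alone. The domain of the `k`-th power need not be relatively compact: for `k = 0` it is all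
      -- of `X`.
      have hcl := closure_mono (inter_subset_left (s := θ '' W)
        (t := (natPow (θ.restrOpen W hW.isOpen) k).source))
      exact (hθW.inter ih).image (hcompact.of_isClosed_subset isClosed_closure hcl)
        (hcl.trans hsub)
  have htarget : ∀ k : ℕ, IsRegularOpen (natPow (θ.restrOpen W hW.isOpen) k).target := by
    intro k
    induction k with
    | zero => exact isRegularOpen_univ
    | succ k ih =>
      have : (natPow (θ.restrOpen W hW.isOpen) (k + 1)).target =
          θ '' (W ∩ (natPow (θ.restrOpen W hW.isOpen) k).target) := by
        ext z
        simp only [mem_target_iff, natPow, rel_trans, rel_restrOpen]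
        constructor
        · rintro ⟨x, y, hy, hyW, h⟩
          exact ⟨y, ⟨hyW, mem_target_iff.2 ⟨x, hy⟩⟩, h.2⟩
        · rintro ⟨y, ⟨hyW, hy⟩, rfl⟩
          obtain ⟨x, hx⟩ := mem_target_iff.1 hy
          exact ⟨x, y, hx, hyW, hsW hyW, rfl⟩
      rw [this]
      have hcl := closure_mono (inter_subset_left (s := W)
        (t := (natPow (θ.restrOpen W hW.isOpen) k).target))
      exact (hW.inter ih).image (hc.of_isClosed_subset isClosed_closure hcl) (hcl.trans hs)
  change IsRegularOpen (zPow (θ.restrOpen W hW.isOpen) (-n)).source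
  rcases -n with k | k
  · exact hsource k
  · exact htarget (k + 1)

end Restriction

universe u v

/-! ### Approximation in the ideals `C₀(U)`. -/

section Approximation

open Filter

variable {X : Type u} [TopologicalSpace X]

theorem norm_apply_le (f : C₀(X, ℂ)) (x : X) : ‖f x‖ ≤ ‖f‖ := f.toBCF.norm_coe_le_norm x

theorem norm_le_of_apply {f : C₀(X, ℂ)} {C : ℝ} (hC : 0 ≤ C) (h : ∀ x, ‖f x‖ ≤ C) : ‖f‖ ≤ C :=
  (BoundedContinuousFunction.norm_le (f := f.toBCF) hC).2 h

/-- A function vanishing at infinity is uniformly close to one supported where it is not small. -/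
theorem exists_truncation (f : C₀(X, ℂ)) {ε : ℝ} (hε : 0 < ε) :
    ∃ g : C₀(X, ℂ), ‖f - g‖ ≤ ε ∧ ∀ x, ‖f x‖ ≤ ε → g x = 0 := by
  -- The cutoff is `0` where `‖f x‖ ≤ ε` and `1 - ε / ‖f x‖` elsewhere, so multiplying by it lowers
  -- the modulus by at most `ε`. The maximum in the denominator keeps it nonzero.
  let φ : C(X, ℝ) :=
    ⟨fun x => max (‖f x‖ - ε) 0 / max ‖f x‖ ε, by
      refine Continuous.div (by fun_prop) (by fun_prop) fun x => ?_
      exact (lt_max_of_lt_right hε).ne'⟩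
  have hφ : ∀ x, 0 ≤ φ x ∧ φ x ≤ 1 := fun x => by
    have h1 : 0 < max ‖f x‖ ε := lt_max_of_lt_right hε
    refine ⟨div_nonneg (le_max_right _ _) h1.le, (div_le_one h1).2 (max_le_max ?_ hε.le)⟩
    linarith
  have hsmall : ∀ x, ‖f x‖ * (1 - φ x) ≤ ε := fun x => by
    rcases le_total ‖f x‖ ε with h | h
    · nlinarith [hφ x, norm_nonneg (f x)]
    · have h0 : 0 < ‖f x‖ := hε.trans_le h
      have : φ x = (‖f x‖ - ε) / ‖f x‖ := by
        change max (‖f x‖ - ε) 0 / max ‖f x‖ ε = _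
        rw [max_eq_left h, max_eq_left (sub_nonneg.2 h)]
      rw [this]
      field_simp
      linarith
  let g : C₀(X, ℂ) :=
    { toFun := fun x => (φ x : ℂ) * f x
      continuous_toFun := by fun_prop
      zero_at_infty' := by
        refine squeeze_zero_norm (fun x => ?_) (by simpa using (zero_at_infty f).norm)
        rw [norm_mul, Complex.norm_real, Real.norm_of_nonneg (hφ x).1]
        exact mul_le_of_le_one_left (norm_nonneg _) (hφ x).2 }
  refine ⟨g, norm_le_of_apply hε.le fun x => ?_, fun x hx => ?_⟩
  · have : (f - g) x = ((1 - φ x : ℝ) : ℂ) * f x := by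
      change f x - (φ x : ℂ) * f x = _
      push_cast
      ring
    rw [this, norm_mul, Complex.norm_real, Real.norm_of_nonneg (by linarith [(hφ x).2]), mul_comm]
    exact hsmall x
  · change (φ x : ℂ) * f x = 0
    have : φ x = 0 := by
      change max (‖f x‖ - ε) 0 / max ‖f x‖ ε = 0
      rw [max_eq_right (sub_nonpos.2 hx), zero_div]
    rw [this, Complex.ofReal_zero, zero_mul]

/-- If the open set `U` is the increasing union of the open sets `V i`, every element of `C₀(U)` is
the limit of a sequence of elements of the ideals `C₀(V i)`. -/
theorem exists_tendsto_ideal {V : ℕ → Set X} {U : Set X} (hV : ∀ i, IsOpen (V i))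
    (hmono : Monotone V) (hU : U ⊆ ⋃ i, V i) (f : ideal U) :
    ∃ a : ∀ i, ideal (V i), Tendsto (fun i => (a i).1) atTop (𝓝 f.1) := by
  have hclose : ∀ ε > 0, ∃ N, ∀ i ≥ N, ∃ a : ideal (V i), ‖f.1 - a.1‖ ≤ ε := by
    intro ε hε
    obtain ⟨g, hg, hg0⟩ := exists_truncation f.1 hε
    obtain ⟨t, ht, hts⟩ : ∃ t, IsCompact t ∧ tᶜ ⊆ {x | ‖f.1 x‖ < ε} := by
      refine Filter.mem_cocompact.1 ?_
      have := (zero_at_infty f.1).norm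
      rw [norm_zero] at this
      exact this.eventually_lt_const hε
    have hK : IsCompact {x | ε ≤ ‖f.1 x‖} := by
      refine ht.of_isClosed_subset (isClosed_le continuous_const (by fun_prop)) fun x hx => ?_
      by_contra hxt
      exact not_lt.2 (show ε ≤ ‖f.1 x‖ from hx) (hts hxt)
    -- The compact set where `‖f‖ ≥ ε` lies in `U`, hence in a single `V N`, which therefore
    -- contains all points where the truncation is nonzero.
    obtain ⟨N, hN⟩ := hK.elim_directed_cover V hV (fun x hx => hU (by
      by_contra hxU
      have hx' : ε ≤ ‖f.1 x‖ := hx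
      rw [f.2 x hxU, norm_zero] at hx'
      exact absurd hε (not_lt.2 hx'))) hmono.directed_le
    refine ⟨N, fun i hi => ⟨⟨g, fun x hx => hg0 x ?_⟩, hg⟩⟩
    by_contra hlt
    exact hx (hmono hi (hN (not_le.1 hlt).le))
  have hne : ∀ i, (ideal (V i) : Set C₀(X, ℂ)).Nonempty := fun i => ⟨0, zero_mem _⟩
  have hpos : ∀ i : ℕ, (0 : ℝ) < 1 / ((i : ℝ) + 1) := fun i => Nat.one_div_pos_of_nat
  -- Near-best approximants are chosen for every index at once. The slack `1 / (i + 1)` is there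
  -- because the distance need not be attained.
  have hchoice : ∀ i : ℕ, ∃ a : ideal (V i),
      dist f.1 a.1 < Metric.infDist f.1 (ideal (V i)) + 1 / ((i : ℝ) + 1) := fun i => by
    obtain ⟨a, ha, h⟩ := (Metric.infDist_lt_iff (hne i)).1
      (lt_add_of_pos_right (Metric.infDist f.1 (ideal (V i) : Set C₀(X, ℂ))) (hpos i))
    exact ⟨⟨a, ha⟩, h⟩
  choose a ha using hchoice
  refine ⟨a, tendsto_iff_dist_tendsto_zero.2 ?_⟩
  have hinf : Tendsto (fun i => Metric.infDist f.1 (ideal (V i) : Set C₀(X, ℂ))) atTop (𝓝 0) := by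
    rw [Metric.tendsto_atTop]
    intro ε hε
    obtain ⟨N, hN⟩ := hclose (ε / 2) (half_pos hε)
    refine ⟨N, fun i hi => ?_⟩
    obtain ⟨b, hb⟩ := hN i hi
    rw [Real.dist_0_eq_abs, abs_of_nonneg Metric.infDist_nonneg]
    have := Metric.infDist_le_dist_of_mem (x := f.1) b.2
    rw [dist_eq_norm] at this
    linarith
  refine squeeze_zero (fun _ => dist_nonneg) (fun i => ?_)
    (by simpa only [add_zero] using hinf.add tendsto_one_div_add_atTop_nhds_zero_nat)
  rw [dist_comm]
  exact (ha i).le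

end Approximation

/-! ### Estimates on coefficients and the universal property of the crossed product. -/

namespace PartialAction

open Filter

variable {G : Type v} [AddGroup G] {X : Type u} [TopologicalSpace X]

theorem isOpen_dom (α : PartialAction G X) (g : G) : IsOpen (α.dom g) := by
  rw [← α.target_eq]
  exact (α.map g).open_target

variable [T2Space X]

section

variable (α : PartialAction G X)

/-- At each point of `D g` the product is `a y * b x` with `x` the preimage of `y`, so the usual
splitting `ab - fk = (a - f)b + f(b - k)` works pointwise. -/
theorem norm_coeffMul_sub_le {g h : G} (a f : ideal (α.dom g)) (b k : ideal (α.dom h)) :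
    ‖(α.coeffMul a b).1 - (α.coeffMul f k).1‖ ≤
      ‖a.1 - f.1‖ * ‖b.1‖ + ‖f.1‖ * ‖b.1 - k.1‖ := by
  refine norm_le_of_apply (by positivity) fun y => ?_
  rw [ZeroAtInftyContinuousMap.sub_apply]
  by_cases hy : y ∈ α.dom g
  · obtain ⟨x, hx⟩ := α.exists_rel_of_mem hy
    rw [α.coeffMul_of_rel _ _ hx, α.coeffMul_of_rel _ _ hx,
      show a.1 y * b.1 x - f.1 y * k.1 x = (a.1 - f.1) y * b.1 x + f.1 y * (b.1 - k.1) x by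
        simp only [ZeroAtInftyContinuousMap.sub_apply]; ring]
    refine norm_add_le_of_le ?_ ?_
    · rw [norm_mul]
      exact mul_le_mul (norm_apply_le _ y) (norm_apply_le _ x) (norm_nonneg _) (norm_nonneg _)
    · rw [norm_mul]
      exact mul_le_mul (norm_apply_le _ y) (norm_apply_le _ x) (norm_nonneg _) (norm_nonneg _)
  · rw [α.coeffMul_of_notMem _ _ hy, α.coeffMul_of_notMem _ _ hy, sub_zero, norm_zero]
    positivity

theorem norm_coeffStar_sub_le {g : G} (a f : ideal (α.dom g)) :
    ‖(α.coeffStar a).1 - (α.coeffStar f).1‖ ≤ ‖a.1 - f.1‖ := by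
  refine norm_le_of_apply (norm_nonneg _) fun x => ?_
  rw [ZeroAtInftyContinuousMap.sub_apply]
  by_cases hx : x ∈ α.dom (-g)
  · obtain ⟨y, hy⟩ := α.exists_rel_of_mem hx
    rw [α.coeffStar_of_rel a (α.rel_neg_iff.1 hy), α.coeffStar_of_rel f (α.rel_neg_iff.1 hy),
      ← star_sub, norm_star]
    exact norm_apply_le (a.1 - f.1) y
  · rw [α.coeffStar_of_notMem _ hx, α.coeffStar_of_notMem _ hx, sub_zero, norm_zero]
    exact norm_nonneg _

variable [DecidableEq G]

/-- The maximal norm dominates every `*`-homomorphism into a C*-algebra. -/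
theorem norm_hom_le {B : Type (max u v)} [NonUnitalCStarAlgebra B] (π : α.Alg →⋆ₙₐ[ℂ] B)
    (x : α.Alg) : ‖π x‖ ≤ ‖x‖ := by
  obtain ⟨H, _, _, _, σ, hσ⟩ := NonUnitalCStarAlgebra.exists_norm_le_rep (π x)
  exact hσ.trans (α.norm_rep_le (σ.comp π) x)

theorem norm_δ_le {g : G} (a : ideal (α.dom g)) : ‖α.δ g a‖ ≤ ‖a.1‖ :=
  α.maxNorm_le fun _ _ _ _ π => α.norm_rep_δ_le π a

theorem continuous_hom {B : Type*} [NonUnitalCStarAlgebra B] (Φ : α.CrossedProduct →⋆ₙₐ[ℂ] B) :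
    Continuous Φ :=
  (AddMonoidHomClass.lipschitz_of_bound Φ 1 fun x => by
    rw [one_mul]; exact NonUnitalStarAlgHom.norm_apply_le Φ x).continuous

open UniformSpace UniformSpace.Completion in
/-- The universal property of the partial crossed product. -/
theorem exists_extension {B : Type (max u v)} [NonUnitalCStarAlgebra B]
    (π : α.Alg →⋆ₙₐ[ℂ] B) : ∃ Ψ : α.CrossedProduct →⋆ₙₐ[ℂ] B, ∀ x, Ψ (α.ι x) = π x := by
  have hu : UniformContinuous π := (AddMonoidHomClass.lipschitz_of_bound π 1 fun x => by
    rw [one_mul]; exact α.norm_hom_le π x).uniformContinuous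
  let F : α.CrossedProduct → B := Completion.extension π
  have hF : Continuous F := continuous_extension
  have hι : ∀ x, F (α.ι x) = π x := fun x => extension_coe hu x
  refine ⟨
    { toFun := F
      map_smul' := fun c x => ?_
      map_zero' := by rw [← α.ι_zero, hι, map_zero]
      map_add' := fun x y => ?_
      map_mul' := fun x y => ?_
      map_star' := fun x => ?_ }, hι⟩
  · induction x using α.cp_induction with
    | hp => exact isClosed_eq (hF.comp (continuous_id.const_smul c)) (hF.const_smul c)
    | h x => rw [← ι_smul, hι, hι, map_smul]; rfl
  · refine α.cp_induction₂ (p := fun x y => F (x + y) = F x + F y) x y (isClosed_eq ?_ ?_)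
      fun x y => by rw [← ι_add, hι, hι, hι, map_add]
    · exact hF.comp (continuous_fst.add continuous_snd)
    · exact (hF.comp continuous_fst).add (hF.comp continuous_snd)
  · refine α.cp_induction₂ (p := fun x y => F (x * y) = F x * F y) x y (isClosed_eq ?_ ?_)
      fun x y => by rw [← ι_mul, hι, hι, hι, map_mul]
    · exact hF.comp (continuous_fst.mul continuous_snd)
    · exact (hF.comp continuous_fst).mul (hF.comp continuous_snd)
  · change F (star x) = star (F x)
    induction x using α.cp_induction with
    | hp => exact isClosed_eq (hF.comp continuous_star) hF.star
    | h x => rw [← ι_star, hι, hι, map_star]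

/-- The restriction of a `*`-homomorphism to the algebraic crossed product. -/
def restrictAlg {B : Type*} [NonUnitalCStarAlgebra B] (ψ : α.CrossedProduct →⋆ₙₐ[ℂ] B) :
    α.Alg →⋆ₙₐ[ℂ] B where
  toFun x := ψ (α.ι x)
  map_smul' c x := by rw [ι_smul, map_smul]; rfl
  map_zero' := by rw [ι_zero, map_zero]
  map_add' x y := by rw [ι_add, map_add]
  map_mul' x y := by rw [ι_mul, map_mul]
  map_star' x := by rw [ι_star, map_star]

end

/-- Where the larger action is defined and the smaller is not, the coefficient `a` vanishes.
Products in the varying actions can thus be estimated inside the fixed action `β`. -/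
theorem IsRestriction.coeffMul_apply {α β : PartialAction G X} (h : α.IsRestriction β) {g k : G}
    (a : ideal (α.dom g)) (b : ideal (α.dom k)) (y : X) :
    (β.coeffMul (h.coeffIncl g a) (h.coeffIncl k b)).1 y = (α.coeffMul a b).1 y := by
  by_cases hy : y ∈ α.dom g
  · obtain ⟨x, hx⟩ := α.exists_rel_of_mem hy
    rw [α.coeffMul_of_rel _ _ hx, β.coeffMul_of_rel _ _ ((h g).rel hx)]
    rfl
  · rw [α.coeffMul_of_notMem _ _ hy]
    by_cases hy' : y ∈ β.dom g
    · obtain ⟨x, hx⟩ := β.exists_rel_of_mem hy'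
      rw [β.coeffMul_of_rel _ _ hx]
      change a.1 y * b.1 x = 0
      rw [α.coe_eq_zero a hy, zero_mul]
    · rw [β.coeffMul_of_notMem _ _ hy']

theorem IsRestriction.coeffStar_apply {α β : PartialAction G X} (h : α.IsRestriction β) {g : G}
    (a : ideal (α.dom g)) (x : X) :
    (β.coeffStar (h.coeffIncl g a)).1 x = (α.coeffStar a).1 x := by
  refine β.coeffStar_apply_eq _ _ _ (fun y hy => ?_) fun hx => ?_
  · change _ = star (a.1 y)
    refine α.coeffStar_apply_eq _ _ _ (fun z hz => ?_) fun hx => ?_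
    · rw [← hy.2, ((h g).rel hz).2]
    · by_cases hya : y ∈ α.dom g
      · obtain ⟨z, hz⟩ := α.exists_rel_of_mem hya
        -- Injectivity of the larger map makes the preimage of `y` under the smaller action equal to
        -- `x`, contradicting `hx`.
        obtain rfl : z = x := (β.map g).injOn ((h g).rel hz).1 hy.1
          (((h g).rel hz).2.trans hy.2.symm)
        exact absurd (α.mem_of_rel (α.rel_neg hz)) hx
      · rw [α.coe_eq_zero a hya, star_zero]
  · exact α.coeffStar_of_notMem a fun hx' => hx (h.dom_subset _ hx')

end PartialAction

/-! ### Gluing compatible homomorphisms along an increasing sequence of partial actions. -/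

namespace PartialAction

open Filter

variable {G : Type v} [AddGroup G] {X : Type u} [TopologicalSpace X]
  {α : ℕ → PartialAction G X} {β : PartialAction G X}

/-- Uniform convergence to `f ∈ C₀(D g)` of coefficients `a i ∈ C₀(D g)` of the partial
actions `α i`. -/
def CoeffTendsto {g : G} (a : ∀ i, ideal ((α i).dom g)) (f : ideal (β.dom g)) : Prop :=
  Tendsto (fun i => (a i).1) atTop (𝓝 f.1)

theorem exists_coeffTendsto (hmono : ∀ i j, i ≤ j → (α i).IsRestriction (α j))
    (hdom : ∀ g, β.dom g ⊆ ⋃ i, (α i).dom g) {g : G} (f : ideal (β.dom g)) :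
    ∃ a : ∀ i, ideal ((α i).dom g), CoeffTendsto a f :=
  exists_tendsto_ideal (fun i => (α i).isOpen_dom g) (fun i j hij => (hmono i j hij).dom_subset g)
    (hdom g) f

variable [T2Space X]

theorem CoeffTendsto.coeffMul (hres : ∀ i, (α i).IsRestriction β) {g h : G}
    {a : ∀ i, ideal ((α i).dom g)} {f : ideal (β.dom g)} {b : ∀ i, ideal ((α i).dom h)}
    {k : ideal (β.dom h)} (ha : CoeffTendsto a f) (hb : CoeffTendsto b k) :
    CoeffTendsto (fun i => (α i).coeffMul (a i) (b i)) (β.coeffMul f k) := by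
  refine tendsto_iff_norm_sub_tendsto_zero.2 (squeeze_zero (fun _ => norm_nonneg _) (fun i => ?_)
    (show Tendsto (fun i => ‖(a i).1 - f.1‖ * ‖(b i).1‖ + ‖f.1‖ * ‖(b i).1 - k.1‖) atTop (𝓝 0) by
      simpa using ((tendsto_iff_norm_sub_tendsto_zero.1 ha).mul (Tendsto.norm hb)).add
        ((tendsto_iff_norm_sub_tendsto_zero.1 hb).const_mul ‖f.1‖)))
  rw [show ((α i).coeffMul (a i) (b i)).1 =
    (β.coeffMul ((hres i).coeffIncl g (a i)) ((hres i).coeffIncl h (b i))).1 from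
      ZeroAtInftyContinuousMap.ext fun y => ((hres i).coeffMul_apply _ _ y).symm]
  exact β.norm_coeffMul_sub_le _ _ _ _

theorem CoeffTendsto.coeffStar (hres : ∀ i, (α i).IsRestriction β) {g : G}
    {a : ∀ i, ideal ((α i).dom g)} {f : ideal (β.dom g)} (ha : CoeffTendsto a f) :
    CoeffTendsto (fun i => (α i).coeffStar (a i)) (β.coeffStar f) := by
  refine tendsto_iff_norm_sub_tendsto_zero.2 (squeeze_zero (fun _ => norm_nonneg _) (fun i => ?_)
    (tendsto_iff_norm_sub_tendsto_zero.1 ha))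
  rw [show ((α i).coeffStar (a i)).1 = (β.coeffStar ((hres i).coeffIncl g (a i))).1 from
      ZeroAtInftyContinuousMap.ext fun y => ((hres i).coeffStar_apply _ y).symm]
  exact β.norm_coeffStar_sub_le _ _

variable [DecidableEq G]

/-- Compatibility moves both terms to the index `max i j`, where a single homomorphism is
contractive on coefficients. The bound is uniform in the indices and makes all the limits below
exist. -/
theorem norm_sub_hom_δ_le (hmono : ∀ i j, i ≤ j → (α i).IsRestriction (α j)) {B : Type*}
    [NonUnitalCStarAlgebra B] {ρ : ∀ i, (α i).Alg →⋆ₙₐ[ℂ] B}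
    (hρ : ∀ i j (hij : i ≤ j) x, ρ j ((hmono i j hij).algIncl x) = ρ i x) {g : G} {i j : ℕ}
    (a : ideal ((α i).dom g)) (b : ideal ((α j).dom g)) :
    ‖ρ i ((α i).δ g a) - ρ j ((α j).δ g b)‖ ≤ ‖a.1 - b.1‖ := by
  have hincl : ∀ k l (hkl : k ≤ l) (c : ideal ((α k).dom g)),
      ρ k ((α k).δ g c) = ρ l ((α l).δ g ((hmono k l hkl).coeffIncl g c)) := fun k l hkl c => by
    rw [← hρ k l hkl]
    exact congrArg _ ((hmono k l hkl).algInclₗ_δ c)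
  rw [hincl i _ (le_max_left i j), hincl j _ (le_max_right i j), ← map_sub, ← map_sub]
  exact (α (max i j)).norm_rep_δ_le (ρ _) _

/-- Uniformly Cauchy coefficients have Cauchy images by the preceding estimate, and `B` is complete.
One limit `b` serves all approximating sequences, so algebraic identities can be checked on
whichever sequence is convenient. -/
theorem exists_limit_δ (hmono : ∀ i j, i ≤ j → (α i).IsRestriction (α j))
    (hdom : ∀ g, β.dom g ⊆ ⋃ i, (α i).dom g) {B : Type*}
    [NonUnitalCStarAlgebra B] {ρ : ∀ i, (α i).Alg →⋆ₙₐ[ℂ] B}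
    (hρ : ∀ i j (hij : i ≤ j) x, ρ j ((hmono i j hij).algIncl x) = ρ i x) {g : G}
    (f : ideal (β.dom g)) : ∃ b : B, ∀ a : ∀ i, ideal ((α i).dom g), CoeffTendsto a f →
      Tendsto (fun i => ρ i ((α i).δ g (a i))) atTop (𝓝 b) := by
  obtain ⟨c, hc⟩ := exists_coeffTendsto hmono hdom f
  have hcauchy : CauchySeq fun i => ρ i ((α i).δ g (c i)) := by
    rw [Metric.cauchySeq_iff]
    intro ε hε
    obtain ⟨N, hN⟩ := Metric.cauchySeq_iff.1 hc.cauchySeq ε hε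
    refine ⟨N, fun m hm n hn => lt_of_le_of_lt ?_ (hN m hm n hn)⟩
    rw [dist_eq_norm, dist_eq_norm]
    exact norm_sub_hom_δ_le hmono hρ _ _
  obtain ⟨b, hb⟩ := cauchySeq_tendsto_of_complete hcauchy
  refine ⟨b, fun a ha => tendsto_of_tendsto_of_dist hb ?_⟩
  refine squeeze_zero (fun _ => dist_nonneg) (fun i => ?_)
    (by simpa using (Tendsto.sub hc ha).norm)
  rw [dist_eq_norm]
  exact norm_sub_hom_δ_le hmono hρ _ _

/-- Compatible `*`-homomorphisms on the algebraic crossed products of an increasing sequence of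
partial actions extend to the algebraic crossed product of the union. -/
theorem exists_algHom (hmono : ∀ i j, i ≤ j → (α i).IsRestriction (α j))
    (hres : ∀ i, (α i).IsRestriction β) (hdom : ∀ g, β.dom g ⊆ ⋃ i, (α i).dom g) {B : Type*}
    [NonUnitalCStarAlgebra B] {ρ : ∀ i, (α i).Alg →⋆ₙₐ[ℂ] B}
    (hρ : ∀ i j (hij : i ≤ j) x, ρ j ((hmono i j hij).algIncl x) = ρ i x) :
    ∃ π : β.Alg →⋆ₙₐ[ℂ] B, ∀ i x, π ((hres i).algIncl x) = ρ i x := by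
  choose T hT using fun g (f : ideal (β.dom g)) => exists_limit_δ hmono hdom hρ f
  have happrox := fun g (f : ideal (β.dom g)) => exists_coeffTendsto hmono hdom f
  let Tₗ : ∀ g, ideal (β.dom g) →ₗ[ℂ] B := fun g =>
    { toFun := T g
      map_add' := fun f k => by
        obtain ⟨a, ha⟩ := happrox g f
        obtain ⟨b, hb⟩ := happrox g k
        refine tendsto_nhds_unique (hT g (f + k) (fun i => a i + b i) (Tendsto.add ha hb))
          (((hT g f a ha).add (hT g k b hb)).congr fun i => ?_)
        rw [map_add, map_add]
      map_smul' := fun c f => by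
        obtain ⟨a, ha⟩ := happrox g f
        refine tendsto_nhds_unique (hT g (c • f) (fun i => c • a i) (Tendsto.const_smul ha c))
          (((hT g f a ha).const_smul c).congr fun i => ?_)
        rw [map_smul, map_smul] }
  have hπ : ∀ g f, β.lift Tₗ (β.δ g f) = T g f := fun g f => β.lift_δ _ g f
  let π : β.Alg →⋆ₙₐ[ℂ] B :=
    { toFun := β.lift Tₗ
      map_smul' := fun c x => (β.lift Tₗ).map_smul c x
      map_zero' := (β.lift Tₗ).map_zero
      map_add' := (β.lift Tₗ).map_add
      map_mul' := fun x y => by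
        induction x using β.alg_induction with
        | h0 => simp
        | hadd x x' hx hx' => simp only [add_mul, map_add, hx, hx']
        | hδ g f =>
          induction y using β.alg_induction with
          | h0 => simp
          | hadd y y' hy hy' => simp only [mul_add, map_add, hy, hy']
          | hδ k f' =>
            rw [δ_mul_δ, hπ, hπ, hπ]
            obtain ⟨a, ha⟩ := happrox g f
            obtain ⟨b, hb⟩ := happrox k f'
            -- The products of approximants approximate the product coefficient, so both sides are
            -- limits of the same sequence in `B`.
            refine tendsto_nhds_unique (hT _ _ _ (ha.coeffMul hres hb))
              (((hT g f a ha).mul (hT k f' b hb)).congr fun i => ?_)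
            rw [← map_mul, δ_mul_δ]
      map_star' := fun x => by
        induction x using β.alg_induction with
        | h0 => simp
        | hadd x x' hx hx' => simp only [star_add, map_add, hx, hx']
        | hδ g f =>
          rw [star_δ, hπ, hπ]
          obtain ⟨a, ha⟩ := happrox g f
          refine tendsto_nhds_unique (hT _ _ _ (ha.coeffStar hres))
            ((hT g f a ha).star.congr fun i => ?_)
          rw [← map_star, star_δ] }
  refine ⟨π, fun i x => ?_⟩
  induction x using (α i).alg_induction with
  | h0 => simp
  | hadd x x' hx hx' => simp only [map_add, hx, hx']
  | hδ g a =>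
    have h1 : π ((hres i).algIncl ((α i).δ g a)) = T g ((hres i).coeffIncl g a) :=
      (congrArg π ((hres i).algInclₗ_δ a)).trans (hπ g _)
    rw [h1]
    -- The constant sequence `a` is not available, since `a` need not belong to the ideals of index
    -- below `i`. An approximating sequence is compared with `a` instead.
    obtain ⟨b, hb⟩ := happrox g ((hres i).coeffIncl g a)
    refine tendsto_nhds_unique (hT g _ b hb) (tendsto_iff_norm_sub_tendsto_zero.2 ?_)
    refine squeeze_zero (fun _ => norm_nonneg _)
      (fun j => norm_sub_hom_δ_le hmono hρ (b j) a) ?_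
    exact tendsto_iff_norm_sub_tendsto_zero.1 hb

/-- The images of the smaller crossed products are jointly dense: uniform convergence of
coefficients implies convergence of `a δ_g` in the maximal norm. Homomorphisms of C*-algebras are
automatically continuous. -/
theorem hom_ext_of_dom_subset (hmono : ∀ i j, i ≤ j → (α i).IsRestriction (α j))
    (hres : ∀ i, (α i).IsRestriction β) (hdom : ∀ g, β.dom g ⊆ ⋃ i, (α i).dom g) {B : Type*}
    [NonUnitalCStarAlgebra B] {Φ Ψ : β.CrossedProduct →⋆ₙₐ[ℂ] B}
    (h : ∀ i x, Φ ((hres i).cpMap x) = Ψ ((hres i).cpMap x)) : Φ = Ψ := by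
  have hΦ : Continuous Φ := β.continuous_hom Φ
  have hΨ : Continuous Ψ := β.continuous_hom Ψ
  ext x
  induction x using β.cp_induction with
  | hp => exact isClosed_eq hΦ hΨ
  | h x =>
    induction x using β.alg_induction with
    | h0 => rw [ι_zero, map_zero, map_zero]
    | hadd x y hx hy => rw [ι_add, map_add, map_add, hx, hy]
    | hδ g f =>
      obtain ⟨a, ha⟩ := exists_coeffTendsto hmono hdom f
      have hlim : Tendsto (fun i => β.ι (β.δ g ((hres i).coeffIncl g (a i)))) atTop
          (𝓝 (β.ι (β.δ g f))) := by
        refine (β.continuous_ι.tendsto _).comp (tendsto_iff_norm_sub_tendsto_zero.2 ?_)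
        refine squeeze_zero (fun _ => norm_nonneg _) (fun i => ?_)
          (tendsto_iff_norm_sub_tendsto_zero.1 ha)
        rw [← map_sub]
        exact β.norm_δ_le _
      refine tendsto_nhds_unique ((hΦ.tendsto _).comp hlim)
        (((hΨ.tendsto _).comp hlim).congr fun i => ?_)
      have := h i ((α i).ι ((α i).δ g (a i)))
      rw [(hres i).cpMap_ι, show (hres i).algIncl ((α i).δ g (a i)) = _ from
        (hres i).algInclₗ_δ (a i)] at this
      exact this.symm

/-! ### Functoriality of the canonical maps and the inductive limit. -/

theorem IsRestriction.algIncl_self {α : PartialAction G X} (h : α.IsRestriction α) (x : α.Alg) :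
    h.algIncl x = x := by
  induction x using α.alg_induction with
  | h0 => exact map_zero _
  | hadd x y hx hy => rw [map_add, hx, hy]
  | hδ g a => exact h.algInclₗ_δ a

theorem IsRestriction.algIncl_algIncl {α β γ : PartialAction G X} (h : α.IsRestriction β)
    (h' : β.IsRestriction γ) (h'' : α.IsRestriction γ) (x : α.Alg) :
    h'.algIncl (h.algIncl x) = h''.algIncl x := by
  induction x using α.alg_induction with
  | h0 => simp only [map_zero]
  | hadd x y hx hy => simp only [map_add, hx, hy]
  | hδ g a =>
    exact (congrArg _ (h.algInclₗ_δ a)).trans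
      ((h'.algInclₗ_δ _).trans (h''.algInclₗ_δ a).symm)

theorem IsRestriction.cpMap_self {α : PartialAction G X} (h : α.IsRestriction α)
    (x : α.CrossedProduct) : h.cpMap x = x := by
  induction x using α.cp_induction with
  | hp => exact isClosed_eq h.continuous_cpMapFun continuous_id
  | h x => rw [h.cpMap_ι, h.algIncl_self]

theorem IsRestriction.cpMap_cpMap {α β γ : PartialAction G X} (h : α.IsRestriction β)
    (h' : β.IsRestriction γ) (h'' : α.IsRestriction γ) (x : α.CrossedProduct) :
    h'.cpMap (h.cpMap x) = h''.cpMap x := by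
  induction x using α.cp_induction with
  | hp =>
    exact isClosed_eq (h'.continuous_cpMapFun.comp h.continuous_cpMapFun) h''.continuous_cpMapFun
  | h x => rw [h.cpMap_ι, h'.cpMap_ι, h''.cpMap_ι, h.algIncl_algIncl h' h'']

/-- The partial crossed product of an increasing union of partial actions is the inductive limit
of the partial crossed products. -/
theorem isInductiveLimit_crossedProduct (hmono : ∀ i j, i ≤ j → (α i).IsRestriction (α j))
    (hres : ∀ i, (α i).IsRestriction β) (hdom : ∀ g, β.dom g ⊆ ⋃ i, (α i).dom g) :
    IsInductiveLimit (A := fun i => (α i).CrossedProduct) (fun i j hij => (hmono i j hij).cpMap)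
      (L := β.CrossedProduct) (fun i => (hres i).cpMap) where
  map_self i x := (hmono i i le_rfl).cpMap_self x
  map_map i j k hij hjk x :=
    (hmono i j hij).cpMap_cpMap (hmono j k hjk) (hmono i k (hij.trans hjk)) x
  compatible i j hij x := (hmono i j hij).cpMap_cpMap (hres j) (hres i) x
  universal B _ ψ hψ := by
    -- The gluing takes place on the algebraic crossed products; maximality of the norm then extends
    -- the result to the completion.
    obtain ⟨π, hπ⟩ := exists_algHom hmono hres hdom (ρ := fun i => (α i).restrictAlg (ψ i))
      fun i j hij x => by
        change ψ j ((α j).ι _) = ψ i ((α i).ι x)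
        rw [← hψ i j hij, (hmono i j hij).cpMap_ι]
    obtain ⟨Ψ, hΨ⟩ := β.exists_extension π
    have hfac : ∀ i x, Ψ ((hres i).cpMap x) = ψ i x := fun i x => by
      induction x using (α i).cp_induction with
      | hp =>
        exact isClosed_eq ((β.continuous_hom Ψ).comp (hres i).continuous_cpMapFun)
          ((α i).continuous_hom (ψ i))
      | h x =>
        rw [(hres i).cpMap_ι, hΨ, hπ]
        rfl
    refine ⟨Ψ, hfac, fun Φ hΦ => hom_ext_of_dom_subset hmono hres hdom fun i x => ?_⟩
    rw [hfac]
    exact hΦ i x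

end PartialAction

end PartialDynamics

end

/-! ### The main theorem. -/

theorem propositionp {X : Type*} [TopologicalSpace X] [LocallyCompactSpace X] [T2Space X]
    [SecondCountableTopology X] (θ : OpenPartialHomeomorph X X) :
    ∃ (θs : ℕ → OpenPartialHomeomorph X X)
      (hmono : ∀ i j, i ≤ j → PartialDynamics.IsRestriction (θs i) (θs j))
      (hres : ∀ i, PartialDynamics.IsRestriction (θs i) θ),
      θ.source = ⋃ i, (θs i).source ∧
      (∀ (i : ℕ) (n : ℤ), PartialDynamics.IsRegularOpen ((PartialDynamics.generated (θs i)).dom n)) ∧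
      PartialDynamics.IsInductiveLimit
        (A := fun i => (PartialDynamics.generated (θs i)).CrossedProduct)
        (fun i j hij => (hmono i j hij).generated.cpMap)
        (L := (PartialDynamics.generated θ).CrossedProduct)
        (fun i => (hres i).generated.cpMap) := by
  -- One exhaustion serves both claims: `hreg`, `hc` and `hs` give the regular domains, while `hW`
  -- and `hU` give the limit.
  obtain ⟨W, hW, hreg, hc, hs, hU⟩ := PartialDynamics.exists_regularOpen_exhaustion θ.open_source
  have hmono : ∀ i j, i ≤ j → PartialDynamics.IsRestriction
      (θ.restrOpen (W i) (hreg i).isOpen) (θ.restrOpen (W j) (hreg j).isOpen) :=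
    fun i j hij _ hx => ⟨⟨hx.1, hW hij hx.2⟩, rfl⟩
  have hres : ∀ i, PartialDynamics.IsRestriction (θ.restrOpen (W i) (hreg i).isOpen) θ :=
    fun i _ hx => ⟨hx.1, rfl⟩
  have hsource : θ.source = ⋃ i, (θ.restrOpen (W i) (hreg i).isOpen).source := by
    simp only [OpenPartialHomeomorph.restrOpen_source, ← inter_iUnion, ← hU, inter_self]
  exact ⟨fun i => θ.restrOpen (W i) (hreg i).isOpen, hmono, hres, hsource,
    fun i n => PartialDynamics.isRegularOpen_generated_dom (hreg i) (hc i) (hs i) n,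
    PartialDynamics.PartialAction.isInductiveLimit_crossedProduct
      (fun i j hij => (hmono i j hij).generated) (fun i => (hres i).generated)
      fun _ _ hx => mem_iUnion.2 (PartialDynamics.exists_mem_generated_dom hmono hres hsource hx)⟩
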